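/- Let $k$ be a field of characteristic zero and $m,n\ge 0$. Bidegrees are pairs (parity, weight) $|a|=(p(a),w(a))\in\mathbb Z\times\mathbb Z$, $|a||b|:=p(a)p(b)+w(a)w(b)$, and $\mathrm{Sym}\{\dots\}$ is the free algebra on homogeneous generators modulo $ab=(-1)^{|a||b|}ba$. **Spaces.** $A=\mathcal O(k^{m||n})=\mathrm{Sym}\{x_1,\dots,x_m,y_1,\dots,y_n\}$ with $|x_i|=(0,0)$, $|y_j|=(1,0)$, and $A^!=\mathcal O(k^{n\wedge m})=\mathrm{Sym}\{\xi_1,\dots,\xi_m,\eta_1,\dots,\eta_n\}$ with $|\xi_i|=(0,-1)$, $|\eta_j|=(-1,-1)$. For either algebra, with generators $z_i$: * The polyvectors are $\mathfrak X(\mathcal O)=\mathrm{Sym}\{z_i,\partial_{z_i}\}$, $|\partial_{z_i}|=-|z_i|+(0,-1)$, with product $\wedge$. The Schouten bracket $[-,-]$ is the bi-graded biderivation of bidegree $(0,1)$ with $[P,Q]=-(-1)^{(|P|+(0,1))(|Q|+(0,1))}[Q,P]$, $[P,Q\wedge S]=[P,Q]\wedge S+(-1)^{|Q|(|P|+(0,1))}Q\wedge[P,S]$,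 $[\partial_{z_i},z_j]=\delta_{ij}$ (hence $[z_j,\partial_{z_i}]=-(-1)^{p(z_i)}\delta_{ij}$), $[z_i,z_j]=[\partial_{z_i},\partial_{z_j}]=0$. A Poisson structure is a bivector field $\pi$ (quadratic in the $\partial_{z_i}$) of bidegree $(0,-2)$ with $[\pi,\pi]=0$. Then $\delta^\pi=[-,\pi]$ squares to zero; $\mathrm{HP}=\ker\delta^\pi/\operatorname{im}\delta^\pi$, and $\mathrm{HP}^{s,t}$ consists of the classes of cocycles of bidegree $(-s,-t)$. * Call $z_i$ even or odd according to the parity of $p(z_i)+w(z_i)$. The mixed differential forms are $\tilde\Omega(\mathcal O)=\mathrm{Sym}\{z_i,dz_i,\partial_{z_j},z_j^*\mid z_i\text{ even},z_j\text{ odd}\}$ with $|dz_i|=|z_i|+(0,1)$, $|z_j^*|=|\partial_{z_j}|+(0,1)$. The differential $\tilde d$ is the derivation of bidegree $(0,1)$ with $\tilde dz_i=dz_i$, $\tilde d\partial_{z_j}=(-1)^{w(z_j)}z_j^*$, $\tilde d(dz_i)=\tilde d(z_j^*)=0$. The mixed contraction $\tilde\iota$ is the action of $\mathfrak X(\mathcal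 O)$ on $\tilde\Omega(\mathcal O)$ with $\tilde\iota_{P\wedge Q}=\tilde\iota_P\tilde\iota_Q$, in which $z_i$ ($z_i$ even) and $\partial_{z_j}$ ($z_j$ odd) act by multiplication, $\partial_{z_i}$ ($z_i$ even) acts by the left partial derivative with respect to $dz_i$, and $z_j$ ($z_j$ odd) by that with respect to $z_j^*$. Then $\partial_\pi=[\tilde\iota_\pi,\tilde d]$ squares to zero; $\widetilde{\mathrm{HP}}=\ker\partial_\pi/\operatorname{im}\partial_\pi$, and $\widetilde{\mathrm{HP}}_{s,t}$ consists of the classes of cycles of bidegree $(s,t)$. **Differential calculus.** A (Tamarkin–Tsygan) differential calculus consists of bi-graded vector spaces $H^{\bullet,\bullet}$ (an element $f$ of $H^{s,t}$ having $|f|=(-s,-t)$) and $H_{\bullet,\bullet}$ with: an associative unital bi-graded commutative product $\cup$ on $H^{\bullet,\bullet}$; a bi-graded Lie bracket of bidegree $(0,1)$ on $H^{\bullet,\bullet}$ (skew-symmetry and Jacobi identity with signs from the shifted bidegrees $|f|+(0,1)$) with $[P\cup Q,R]=P\cup[Q,R]+(-1)^{|P||Q|}Q\cup[P,R]$; a unital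 left module structure $\iota:H^{s,t}\otimes H_{u,v}\to H_{u-s,v-t}$; and $d:H_{s,t}\to H_{s,t+1}$ with $d^2=0$ such that, for $L_f=\iota_fd-(-1)^{w(f)}d\iota_f$, $\iota_{[f,g]}=L_f\iota_g-(-1)^{p(g)p(f)+w(g)(w(f)+1)}\iota_gL_f$. **Theorem.** Let $\pi$ be a Poisson structure on $k^{m||n}$ and $\pi^!$ a Poisson structure on $k^{n\wedge m}$. 1. $\wedge$, $[-,-]$, $\tilde\iota$ and $\tilde d$ descend to $(\mathrm{HP}^{\bullet,\bullet}(A),\widetilde{\mathrm{HP}}_{\bullet,\bullet}(A))$ (formed with $\pi$) and make it a differential calculus. 2. The same holds for $(\mathrm{HP}^{\bullet,\bullet}(A^!),\widetilde{\mathrm{HP}}_{\bullet,\bullet}(A^!))$ (formed with $\pi^!$). 3. Let $\Psi:\mathfrak X(A)\to\mathfrak X(A^!)$ and $\Phi:\tilde\Omega(A)\to\tilde\Omega(A^!)$ be the algebra maps given by $$x_i\mapsto-\partial_{\xi_i},\quad \partial_{x_i}\mapsto\xi_i,\quad dx_i\mapsto\xi_i^*,\quad y_j\mapsto\partial_{\eta_j},\quad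 \partial_{y_j}\mapsto\eta_j,\quad y_j^*\mapsto d\eta_j .$$ If $\pi$ and $\pi^!$ are Koszul dual, that is, $\pi$ is a linear combination of terms $z_az_b\,\partial_{z_c}\wedge\partial_{z_d}$ and $\pi^!=\Psi(\pi)$, then $\Psi$ and $\Phi$ induce bidegree-preserving isomorphisms $\mathrm{HP}^{\bullet,\bullet}(A)\cong\mathrm{HP}^{\bullet,\bullet}(A^!)$ and $\widetilde{\mathrm{HP}}_{\bullet,\bullet}(A)\cong\widetilde{\mathrm{HP}}_{\bullet,\bullet}(A^!)$ which form an isomorphism of the two differential calculi. -/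

import Mathlib

namespace BiGraded

/-! ### Bi-graded symmetric algebras

A bidegree is a pair `(parity, weight) : ℤ × ℤ`. -/

/-- The pairing `|x||y| = p(x) p(y) + w(x) w(y)` of bidegrees. -/
def dot (a b : ℤ × ℤ) : ℤ := a.1 * b.1 + a.2 * b.2

/-- The sign `(-1) ^ n`, as an element of `k`. -/
def sgn (k : Type*) [CommRing k] (n : ℤ) : k := ((n.negOnePow : ℤ) : k)

section Sign

variable {k : Type*} [CommRing k]

theorem sgn_add (a b : ℤ) : sgn k (a + b) = sgn k a * sgn k b := by
  simp [sgn, Int.negOnePow_add]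

theorem sgn_congr {a b : ℤ} (h : Even (a - b)) : sgn k a = sgn k b := by
  rw [sgn, sgn, (Int.negOnePow_eq_iff a b).2 h]

theorem dot_add_left (a b c : ℤ × ℤ) : dot (a + b) c = dot a c + dot b c := by
  simp only [dot, Prod.fst_add, Prod.snd_add]; ring

theorem dot_neg_left (a b : ℤ × ℤ) : dot (-a) b = -dot a b := by
  simp only [dot, Prod.fst_neg, Prod.snd_neg]; ring

theorem dot_comm (a b : ℤ × ℤ) : dot a b = dot b a := by
  simp only [dot]; ring

theorem sgn_zero : sgn k 0 = 1 := by simp [sgn]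

theorem sgn_mul_self (a : ℤ) : sgn k a * sgn k a = 1 := by
  rw [← sgn_add, sgn_congr (b := 0) (by simp), sgn_zero]

end Sign

/-- The relations `x y = (-1)^{|x||y|} y x` between the generators. -/
inductive BiSym.Rel (k : Type*) [CommRing k] {I : Type*} (deg : I → ℤ × ℤ) :
    FreeAlgebra k I → FreeAlgebra k I → Prop
  | comm (i j : I) : BiSym.Rel k deg (FreeAlgebra.ι k i * FreeAlgebra.ι k j)
      (sgn k (dot (deg i) (deg j)) • (FreeAlgebra.ι k j * FreeAlgebra.ι k i))

/-- `Sym {g_i}`: the free bi-graded commutative algebra on generators `g_i` of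
bidegree `deg i`. -/
def BiSym (k : Type*) [CommRing k] {I : Type*} (deg : I → ℤ × ℤ) :=
  RingQuot (BiSym.Rel k deg)

namespace BiSym

variable {k : Type*} [CommRing k] {I : Type*} {deg : I → ℤ × ℤ}

instance : Ring (BiSym k deg) := inferInstanceAs (Ring (RingQuot (BiSym.Rel k deg)))

instance : Algebra k (BiSym k deg) := inferInstanceAs (Algebra k (RingQuot (BiSym.Rel k deg)))

/-- The quotient map from the free algebra. -/
def mk (deg : I → ℤ × ℤ) : FreeAlgebra k I →ₐ[k] BiSym k deg :=
  RingQuot.mkAlgHom k (BiSym.Rel k deg)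

/-- The generator `g_i`. -/
def gen (deg : I → ℤ × ℤ) (i : I) : BiSym k deg := mk deg (FreeAlgebra.ι k i)

theorem gen_mul_gen (i j : I) : (gen deg i * gen deg j : BiSym k deg) =
    sgn k (dot (deg i) (deg j)) • (gen deg j * gen deg i) := by
  have h : mk (k := k) deg _ = mk deg _ :=
    RingQuot.mkAlgHom_rel k (BiSym.Rel.comm (k := k) (deg := deg) i j)
  simpa [gen] using h

/-- The component of bidegree `d`: the span of the monomials of bidegree `d`. -/
def gr (k : Type*) [CommRing k] {I : Type*} (deg : I → ℤ × ℤ) (d : ℤ × ℤ) :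
    Submodule k (BiSym k deg) :=
  Submodule.span k {x | ∃ l : List I, (l.map deg).sum = d ∧ x = (l.map (gen deg)).prod}

/-- The universal property. -/
def lift {B : Type*} [Ring B] [Algebra k B] (f : I → B)
    (hf : ∀ i j, f i * f j = sgn k (dot (deg i) (deg j)) • (f j * f i)) :
    BiSym k deg →ₐ[k] B :=
  RingQuot.liftAlgHom k ⟨FreeAlgebra.lift k f, by
    rintro _ _ ⟨i, j⟩
    simpa using hf i j⟩

@[simp]
theorem lift_gen {B : Type*} [Ring B] [Algebra k B] (f : I → B)
    (hf : ∀ i j, f i * f j = sgn k (dot (deg i) (deg j)) • (f j * f i)) (i : I) :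
    lift f hf (gen deg i) = f i := by
  have h : lift f hf (gen deg i) = FreeAlgebra.lift k f (FreeAlgebra.ι k i) :=
    RingQuot.liftAlgHom_mkAlgHom_apply k _ _ _
  simpa using h

theorem induction {P : BiSym k deg → Prop} (hs : ∀ c : k, P (algebraMap k _ c))
    (hg : ∀ i, P (gen deg i)) (hm : ∀ a b, P a → P b → P (a * b))
    (ha : ∀ a b, P a → P b → P (a + b)) (x : BiSym k deg) : P x := by
  obtain ⟨y, rfl⟩ : ∃ y, mk deg y = x := RingQuot.mkAlgHom_surjective k (BiSym.Rel k deg) x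
  induction y using FreeAlgebra.induction with
  | grade0 r => simpa using hs r
  | grade1 i => exact hg i
  | mul a b h1 h2 => simpa using hm _ _ h1 h2
  | add a b h1 h2 => simpa using ha _ _ h1 h2

/-- The automorphism `x ↦ (-1)^{c·|x|} x`. -/
def twist (c : ℤ × ℤ) : BiSym k deg →ₐ[k] BiSym k deg :=
  lift (fun i => sgn k (dot c (deg i)) • gen deg i) fun i j => by
    simp only [smul_mul_smul_comm]
    rw [gen_mul_gen i j, smul_comm, mul_comm (sgn k (dot c (deg i)))]

@[simp]
theorem twist_gen (c : ℤ × ℤ) (i : I) :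
    twist c (gen deg i : BiSym k deg) = sgn k (dot c (deg i)) • gen deg i := by
  simp [twist]

/-- The bi-graded commutation rule that lets `v i` be the value on `g_i` of a derivation
of bidegree `c` (it holds if `v i` is homogeneous of bidegree `deg i + c`). -/
def Compatible (c : ℤ × ℤ) (v : I → BiSym k deg) : Prop :=
  ∀ i j, v i * gen deg j = sgn k (dot (deg i + c) (deg j)) • (gen deg j * v i)

/-- The algebra map `x ↦ [[twist x, D x], [0, x]]` of the left derivation `D` below. -/
def leftDerHom (c : ℤ × ℤ) (v : I → BiSym k deg) (hv : Compatible c v) :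
    BiSym k deg →ₐ[k] Matrix (Fin 2) (Fin 2) (BiSym k deg) :=
  lift (fun i => !![twist c (gen deg i), v i; 0, gen deg i]) fun i j => by
    have h1 : sgn k (dot c (deg i)) • (gen deg i * v j) =
        sgn k (dot (deg i) (deg j)) • (v j * gen deg i) := by
      rw [hv j i, smul_smul, dot_add_left, sgn_add, dot_comm (deg j), ← mul_assoc, sgn_mul_self,
        one_mul]
    have h2 : v i * gen deg j =
        sgn k (dot (deg i) (deg j)) • (sgn k (dot c (deg j)) • (gen deg j * v i)) := by
      rw [hv i j, smul_smul, dot_add_left, sgn_add]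
    have h3 := congrArg (twist c) (gen_mul_gen (k := k) (deg := deg) i j)
    simp only [map_mul, map_smul, twist_gen, smul_mul_smul_comm] at h3
    rw [mul_comm (sgn k (dot c (deg i)))] at h3
    ext a b
    fin_cases a <;> fin_cases b <;> simp [Matrix.mul_apply, Fin.sum_univ_two]
    · simpa [smul_smul, mul_comm, mul_left_comm] using h3
    · rw [h1, h2, add_comm]
    · exact gen_mul_gen i j

/-- The left derivation `D` of bidegree `c`,
`D (x y) = D x y + (-1)^{c·|x|} x D y`, with `D g_i = v i`. -/
def leftDer (c : ℤ × ℤ) (v : I → BiSym k deg) (hv : Compatible c v) :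
    BiSym k deg →ₗ[k] BiSym k deg :=
  Matrix.entryLinearMap k (BiSym k deg) 0 1 ∘ₗ (leftDerHom c v hv).toLinearMap

/-- The algebra map `x ↦ [[x, D x], [0, twist x]]` of the right derivation `D` below. -/
def rightDerHom (c : ℤ × ℤ) (v : I → BiSym k deg) (hv : Compatible c v) :
    BiSym k deg →ₐ[k] Matrix (Fin 2) (Fin 2) (BiSym k deg) :=
  lift (fun i => !![gen deg i, v i; 0, twist c (gen deg i)]) fun i j => by
    have h1 : gen deg i * v j =
        sgn k (dot (deg i) (deg j)) • (sgn k (dot c (deg i)) • (v j * gen deg i)) := by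
      rw [hv j i, smul_smul, smul_smul, dot_add_left, sgn_add, dot_comm (deg j), mul_assoc,
        mul_left_comm (sgn k (dot c (deg i))), sgn_mul_self, mul_one, sgn_mul_self, one_smul]
    have h2 : sgn k (dot c (deg j)) • (v i * gen deg j) =
        sgn k (dot (deg i) (deg j)) • (gen deg j * v i) := by
      rw [hv i j, smul_smul, dot_add_left, sgn_add, mul_left_comm, sgn_mul_self, mul_one]
    have h3 := congrArg (twist c) (gen_mul_gen (k := k) (deg := deg) i j)
    simp only [map_mul, map_smul, twist_gen, smul_mul_smul_comm] at h3
    rw [mul_comm (sgn k (dot c (deg i)))] at h3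
    ext a b
    fin_cases a <;> fin_cases b <;> simp [Matrix.mul_apply, Fin.sum_univ_two]
    · exact gen_mul_gen i j
    · rw [h1, h2, add_comm]
    · simpa [smul_smul, mul_comm, mul_left_comm] using h3

/-- The right derivation `D` of bidegree `c`,
`D (x y) = x D y + (-1)^{c·|y|} D x y`, with `D g_i = v i`. -/
def rightDer (c : ℤ × ℤ) (v : I → BiSym k deg) (hv : Compatible c v) :
    BiSym k deg →ₗ[k] BiSym k deg :=
  Matrix.entryLinearMap k (BiSym k deg) 0 1 ∘ₗ (rightDerHom c v hv).toLinearMap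

theorem leftDerHom_apply (c : ℤ × ℤ) (v : I → BiSym k deg) (hv : Compatible c v)
    (x : BiSym k deg) : leftDerHom c v hv x 1 0 = 0 ∧ leftDerHom c v hv x 1 1 = x ∧
      leftDerHom c v hv x 0 0 = twist c x := by
  induction x using BiSym.induction with
  | hs r => simp [Matrix.algebraMap_matrix_apply]
  | hg i => simp [leftDerHom]
  | hm a b ha hb => simp [Matrix.mul_apply, Fin.sum_univ_two, ha, hb]
  | ha a b ha hb => simp [ha, hb]

theorem leftDer_algebraMap (c : ℤ × ℤ) (v : I → BiSym k deg) (hv : Compatible c v) (r : k) :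
    leftDer c v hv (algebraMap k _ r) = 0 := by
  simp [leftDer, Matrix.algebraMap_matrix_apply]

theorem leftDer_mul (c : ℤ × ℤ) (v : I → BiSym k deg) (hv : Compatible c v) (x y : BiSym k deg) :
    leftDer c v hv (x * y) = leftDer c v hv x * y + twist c x * leftDer c v hv y := by
  simp [leftDer, Matrix.mul_apply, Fin.sum_univ_two, leftDerHom_apply, add_comm]

theorem leftDer_gen (c : ℤ × ℤ) (v : I → BiSym k deg) (hv : Compatible c v) (i : I) :
    leftDer c v hv (gen deg i) = v i := by
  simp [leftDer, leftDerHom]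

section Partial

variable [DecidableEq I]

theorem compatible_single (i : I) :
    Compatible (-deg i) (fun j => if j = i then (1 : BiSym k deg) else 0) := by
  intro a b
  by_cases h : a = i
  · subst h
    simp [dot, sgn_zero]
  · simp [h]

/-- The left partial derivative with respect to `g_i`. -/
def leftPartial (deg : I → ℤ × ℤ) (i : I) : BiSym k deg →ₗ[k] BiSym k deg :=
  leftDer (-deg i) (fun j => if j = i then 1 else 0) (compatible_single i)

/-- The right partial derivative with respect to `g_i`. -/
def rightPartial (deg : I → ℤ × ℤ) (i : I) : BiSym k deg →ₗ[k] BiSym k deg :=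
  rightDer (-deg i) (fun j => if j = i then 1 else 0) (compatible_single i)

theorem leftPartial_gen_mul (i j : I) (x : BiSym k deg) :
    leftPartial deg i (gen deg j * x) =
      (if j = i then x else 0) + sgn k (dot (-deg i) (deg j)) • (gen deg j * leftPartial deg i x) := by
  simp [leftPartial, leftDer_mul, leftDer_gen]

theorem leftPartial_comm (i j : I) (x : BiSym k deg) :
    leftPartial deg i (leftPartial deg j x) =
      sgn k (dot (deg i) (deg j)) • leftPartial deg j (leftPartial deg i x) := by
  suffices h : ∀ a x : BiSym k deg,
      leftPartial deg i (leftPartial deg j x) =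
        sgn k (dot (deg i) (deg j)) • leftPartial deg j (leftPartial deg i x) →
      leftPartial deg i (leftPartial deg j (a * x)) =
        sgn k (dot (deg i) (deg j)) • leftPartial deg j (leftPartial deg i (a * x)) by
    have h1 : ∀ l, leftPartial deg l (1 : BiSym k deg) = 0 := fun l => by
      have := leftDer_algebraMap (-deg l) _ (compatible_single (k := k) (deg := deg) l) 1
      rwa [map_one] at this
    simpa using h x 1 (by simp [h1])
  intro a
  induction a using BiSym.induction with
  | hs r =>
    intro x hx
    simp only [← Algebra.smul_def, map_smul, hx]
    rw [smul_comm]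
  | hg l =>
    intro x hx
    have hn : ∀ a b : ℤ × ℤ, sgn k (dot (-a) b) = sgn k (dot a b) := fun a b =>
      sgn_congr (by rw [dot_neg_left]; exact ⟨-dot a b, by ring⟩)
    simp only [leftPartial_gen_mul, map_add, map_smul, hx, hn]
    rcases eq_or_ne l i with rfl | h1 <;> rcases eq_or_ne l j with rfl | h2
    · simp [smul_smul, sgn_mul_self]
      abel
    · simp [h2, smul_smul, dot_comm (deg j) (deg l), mul_comm]
    · simp [h1, smul_smul, ← mul_assoc, sgn_mul_self]
    · simp [h1, h2, smul_smul, mul_comm, mul_left_comm]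
  | hm a b ha hb =>
    intro x hx
    simp only [mul_assoc]
    exact ha _ (hb _ hx)
  | ha a b ha hb =>
    intro x hx
    simp only [add_mul, map_add, smul_add, ha x hx, hb x hx]

end Partial

end BiSym

open BiSym

/-! ### Polyvectors and the Schouten-Nijenhuis bracket

Throughout, `deg i` is the bidegree of the coordinate `z_i` of a bi-graded space `Σ`, so that
`O(Σ) = Sym {z_i}`. -/

section Calculus

variable {I : Type*}

/-- `Sum.inl i` is the coordinate `z_i`, and `Sum.inr i` is `∂_i`, the derivation `∂/∂z_i` with
its weight shifted by `-1`. -/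
def polyDeg (deg : I → ℤ × ℤ) : I ⊕ I → ℤ × ℤ :=
  Sum.elim deg (fun i => -deg i + (0, -1))

/-- The polyvectors `𝔛(O(Σ)) = Sym {z_i, ∂_i}`. -/
abbrev Polyvector (k : Type*) [CommRing k] (deg : I → ℤ × ℤ) := BiSym k (polyDeg deg)

variable {k : Type*} [CommRing k]

/-- The coordinate `z_i`, as a polyvector. -/
def coord (deg : I → ℤ × ℤ) (i : I) : Polyvector k deg := gen (polyDeg deg) (Sum.inl i)

/-- The vector field `∂_i`. -/
def vect (deg : I → ℤ × ℤ) (i : I) : Polyvector k deg := gen (polyDeg deg) (Sum.inr i)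

/-- The functions `O(Σ)`, as a subalgebra of the polyvectors. -/
def functions (k : Type*) [CommRing k] (deg : I → ℤ × ℤ) : Subalgebra k (Polyvector k deg) :=
  Algebra.adjoin k (Set.range (coord deg))

/-- The bivector fields `𝔛²(O(Σ))`. -/
def bivectors (k : Type*) [CommRing k] (deg : I → ℤ × ℤ) : Submodule k (Polyvector k deg) :=
  Submodule.span k {x | ∃ f ∈ functions k deg, ∃ a b, x = f * vect deg a * vect deg b}

/-- The bivector fields with quadratic coefficients. -/
def quadraticBivectors (k : Type*) [CommRing k] (deg : I → ℤ × ℤ) :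
    Submodule k (Polyvector k deg) :=
  Submodule.span k
    {x | ∃ i j a b, x = coord deg i * coord deg j * vect deg a * vect deg b}

section Bracket

variable [Fintype I] [DecidableEq I]

/-- The Schouten-Nijenhuis bracket
`[P, Q] = ∑ᵢ ((P)∂⃖/∂(∂ᵢ) · ∂⃗Q/∂zᵢ - (-1)^{p(zᵢ)} (P)∂⃖/∂zᵢ · ∂⃗Q/∂(∂ᵢ))`, that is, the bracket
of bidegree `(0, 1)` that is a bi-graded biderivation and satisfies `[∂ᵢ, zⱼ] = δᵢⱼ`,
`[zⱼ, ∂ᵢ] = -(-1)^{p(zᵢ)} δᵢⱼ`, `[zᵢ, zⱼ] = 0` and `[∂ᵢ, ∂ⱼ] = 0`. -/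
def schouten (deg : I → ℤ × ℤ) :
    Polyvector k deg →ₗ[k] Polyvector k deg →ₗ[k] Polyvector k deg :=
  ∑ i, ((LinearMap.mul k (Polyvector k deg)).compl₁₂
      (rightPartial (polyDeg deg) (Sum.inr i)) (leftPartial (polyDeg deg) (Sum.inl i)) -
    sgn k (deg i).1 • (LinearMap.mul k (Polyvector k deg)).compl₁₂
      (rightPartial (polyDeg deg) (Sum.inl i)) (leftPartial (polyDeg deg) (Sum.inr i)))

/-- A Poisson bivector field: `[π, π] = 0`, where, as throughout, only bivector fields of
bidegree `(0, -2)` are considered. -/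
structure IsPoisson (deg : I → ℤ × ℤ) (π : Polyvector k deg) : Prop where
  bivector : π ∈ bivectors k deg
  bidegree : π ∈ gr k (polyDeg deg) (0, -2)
  schouten_self : schouten deg π π = 0

end Bracket

/-! ### Mixed differential forms -/

/-- The coordinate `z_i` is even if `p(z_i) + w(z_i)` is. -/
abbrev IsEven (deg : I → ℤ × ℤ) (i : I) : Prop := Even ((deg i).1 + (deg i).2)

/-- The bidegrees of the generators of the mixed differential forms. `Sum.inl i` is `z_i` if
`z_i` is even and `∂_i` if `z_i` is odd; `Sum.inr i` is `dz_i`, respectively the symbol `z_i^*`. -/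
def formDeg (deg : I → ℤ × ℤ) : I ⊕ I → ℤ × ℤ :=
  Sum.elim (fun i => if IsEven deg i then deg i else -deg i + (0, -1))
    (fun i => (if IsEven deg i then deg i else -deg i + (0, -1)) + (0, 1))

/-- The mixed differential forms
`Ω̃(O(Σ)) = Sym {z_i, dz_i, ∂_j, z_j^* | z_i even, z_j odd}`. -/
abbrev MixedForm (k : Type*) [CommRing k] (deg : I → ℤ × ℤ) := BiSym k (formDeg deg)

/-- The values of `d̃` on the generators: `d̃ z_i = dz_i` for even `z_i` and
`d̃ ∂_j = (-1)^{w(z_j)} z_j^*` for odd `z_j`; `d̃ dz_i = 0` and `d̃ z_j^* = 0`. -/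
def mixedDGen (deg : I → ℤ × ℤ) : I ⊕ I → MixedForm k deg :=
  Sum.elim (fun i => (if IsEven deg i then (1 : k) else sgn k (deg i).2) •
    gen (formDeg deg) (Sum.inr i)) (fun _ => 0)

theorem compatible_mixedDGen (deg : I → ℤ × ℤ) :
    Compatible (0, 1) (mixedDGen (k := k) deg) := by
  rintro (i | i) j
  · simp only [mixedDGen, Sum.elim_inl, smul_mul_assoc, mul_smul_comm]
    rw [gen_mul_gen, smul_comm]
    rfl
  · simp [mixedDGen]

/-- The differential `d̃` on mixed differential forms: the derivation of bidegree `(0, 1)` with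
the above values on generators. -/
def mixedD (deg : I → ℤ × ℤ) : MixedForm k deg →ₗ[k] MixedForm k deg :=
  leftDer (0, 1) (mixedDGen deg) (compatible_mixedDGen deg)

section Contraction

variable [DecidableEq I]

/-- The mixed contraction with `z_i` or `∂_i`: multiplication by `z_i` for even `z_i`, and by
`∂_j` for odd `z_j`; the partial derivative with respect to `dz_i` for `∂_i` with `z_i` even,
and with respect to `z_j^*` for odd `z_j` (so `ι̃_{∂_i} dz_i = 1` and `ι̃_{z_j} z_j^* = 1`). -/
def contractGen (deg : I → ℤ × ℤ) : I ⊕ I → Module.End k (MixedForm k deg) :=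
  Sum.elim
    (fun i => if IsEven deg i then LinearMap.mulLeft k (gen (formDeg deg) (Sum.inl i))
      else leftPartial (formDeg deg) (Sum.inr i))
    (fun i => if IsEven deg i then leftPartial (formDeg deg) (Sum.inr i)
      else LinearMap.mulLeft k (gen (formDeg deg) (Sum.inl i)))

theorem contractGen_cases (deg : I → ℤ × ℤ) (g : I ⊕ I) :
    (∃ i, contractGen (k := k) deg g = LinearMap.mulLeft k (gen (formDeg deg) (Sum.inl i)) ∧
      polyDeg deg g = formDeg deg (Sum.inl i)) ∨
    (∃ i, contractGen (k := k) deg g = leftPartial (formDeg deg) (Sum.inr i) ∧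
      polyDeg deg g = -formDeg deg (Sum.inr i)) := by
  rcases g with i | i <;> by_cases h : IsEven deg i
  · exact Or.inl ⟨i, by simp [contractGen, h], by simp [polyDeg, formDeg, h]⟩
  · refine Or.inr ⟨i, by simp [contractGen, h], ?_⟩
    ext <;> simp [polyDeg, formDeg, h]
  · refine Or.inr ⟨i, by simp [contractGen, h], ?_⟩
    ext <;> simp [polyDeg, formDeg, h]
    ring
  · exact Or.inl ⟨i, by simp [contractGen, h], by simp [polyDeg, formDeg, h]⟩

/-- The mixed contraction `ι̃`, determined by `ι̃_{P ∧ Q} = ι̃_P ∘ ι̃_Q` and its values on `z_i`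
and `∂_i`. -/
def contract (deg : I → ℤ × ℤ) : Polyvector k deg →ₐ[k] Module.End k (MixedForm k deg) :=
  lift (contractGen deg) fun a b => by
    rcases contractGen_cases (k := k) deg a with ⟨i, h1, h2⟩ | ⟨i, h1, h2⟩ <;>
    rcases contractGen_cases (k := k) deg b with ⟨j, h3, h4⟩ | ⟨j, h3, h4⟩ <;>
    rw [h1, h2, h3, h4] <;> ext1 x
    · simp [← mul_assoc, gen_mul_gen (Sum.inl i) (Sum.inl j)]
    · simp [leftPartial_gen_mul, smul_smul, dot_comm (formDeg deg (Sum.inl i)), sgn_mul_self]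
    · simp [leftPartial_gen_mul]
    · simp only [Module.End.mul_apply, LinearMap.smul_apply, dot_neg_left,
        dot_comm _ (-formDeg deg (Sum.inr j)), neg_neg, dot_comm (formDeg deg (Sum.inr j))]
      exact leftPartial_comm _ _ x

end Contraction

end Calculus

/-! ### Poisson cohomology and mixed Poisson homology -/

section Homology

variable {k : Type*} [CommRing k] {I : Type*} [Fintype I] [DecidableEq I]

/-- The Poisson coboundary `δ^π = [-, π]`. -/
def coboundary (deg : I → ℤ × ℤ) (π : Polyvector k deg) :
    Polyvector k deg →ₗ[k] Polyvector k deg :=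
  (schouten deg).flip π

/-- The Poisson cohomology `HP(O(Σ), π) = ker δ^π / im δ^π`. -/
abbrev HP (deg : I → ℤ × ℤ) (π : Polyvector k deg) :=
  LinearMap.ker (coboundary deg π) ⧸
    (LinearMap.range (coboundary deg π)).submoduleOf (LinearMap.ker (coboundary deg π))

/-- The class of a Poisson cocycle. -/
def HP.cls (deg : I → ℤ × ℤ) (π : Polyvector k deg) :
    LinearMap.ker (coboundary deg π) →ₗ[k] HP deg π :=
  Submodule.mkQ _

/-- `HP^{s,t}`: the classes of the cocycles of bidegree `(-s, -t)`. -/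
def HP.grading (deg : I → ℤ × ℤ) (π : Polyvector k deg) (a : ℤ × ℤ) : Submodule k (HP deg π) :=
  ((gr k (polyDeg deg) (-a)).submoduleOf (LinearMap.ker (coboundary deg π))).map (HP.cls deg π)

end Homology

section MixedHomology

variable {k : Type*} [CommRing k] {I : Type*} [DecidableEq I]

/-- The Poisson boundary `∂_π = [ι̃_π, d̃]` (`π` has even weight). -/
def boundary (deg : I → ℤ × ℤ) (π : Polyvector k deg) :
    MixedForm k deg →ₗ[k] MixedForm k deg :=
  contract deg π ∘ₗ mixedD deg - mixedD deg ∘ₗ contract deg π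

/-- The mixed Poisson homology `H̃P(O(Σ), π) = ker ∂_π / im ∂_π`. -/
abbrev MixedHP (deg : I → ℤ × ℤ) (π : Polyvector k deg) :=
  LinearMap.ker (boundary deg π) ⧸
    (LinearMap.range (boundary deg π)).submoduleOf (LinearMap.ker (boundary deg π))

/-- The class of a mixed Poisson cycle. -/
def MixedHP.cls (deg : I → ℤ × ℤ) (π : Polyvector k deg) :
    LinearMap.ker (boundary deg π) →ₗ[k] MixedHP deg π :=
  Submodule.mkQ _

/-- `H̃P_{s,t}`: the classes of the cycles of bidegree `(s, t)`. -/
def MixedHP.grading (deg : I → ℤ × ℤ) (π : Polyvector k deg) (a : ℤ × ℤ) :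
    Submodule k (MixedHP deg π) :=
  ((gr k (formDeg deg) a).submoduleOf (LinearMap.ker (boundary deg π))).map (MixedHP.cls deg π)

end MixedHomology

/-! ### Differential calculi -/

/-- A Tamarkin-Tsygan differential calculus on bi-graded vector spaces `H^{•,•}` and `H_{•,•}`,
whose homogeneous components are `gH` and `gM`. -/
structure DifferentialCalculus (k : Type*) [CommRing k] {H M : Type*}
    [AddCommGroup H] [Module k H] [AddCommGroup M] [Module k M]
    (gH : ℤ × ℤ → Submodule k H) (gM : ℤ × ℤ → Submodule k M) where
  isInternal_left : DirectSum.IsInternal gH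
  isInternal_right : DirectSum.IsInternal gM
  /-- the product `∪` -/
  cup : H →ₗ[k] H →ₗ[k] H
  /-- the unit of `∪` -/
  one : H
  /-- the bracket `[-, -]` -/
  bracket : H →ₗ[k] H →ₗ[k] H
  /-- the action `ι` -/
  iota : H →ₗ[k] M →ₗ[k] M
  /-- the differential `d` -/
  d : M →ₗ[k] M
  one_mem : one ∈ gH 0
  cup_mem : ∀ {a b x y}, x ∈ gH a → y ∈ gH b → cup x y ∈ gH (a + b)
  one_cup : ∀ x, cup one x = x
  cup_assoc : ∀ x y z, cup (cup x y) z = cup x (cup y z)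
  cup_comm : ∀ {a b x y}, x ∈ gH a → y ∈ gH b → cup x y = sgn k (dot a b) • cup y x
  /-- an element of `H^{s,t}` has bidegree `(-s, -t)`; the bracket has bidegree `(0, 1)` -/
  bracket_mem : ∀ {a b x y}, x ∈ gH a → y ∈ gH b → bracket x y ∈ gH (a + b - (0, 1))
  bracket_skew : ∀ {a b x y}, x ∈ gH a → y ∈ gH b →
    bracket x y = -(sgn k (dot (a - (0, 1)) (b - (0, 1))) • bracket y x)
  bracket_jacobi : ∀ {a b c x y z}, x ∈ gH a → y ∈ gH b → z ∈ gH c →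
    sgn k (dot (a - (0, 1)) (c - (0, 1))) • bracket (bracket x y) z +
      sgn k (dot (b - (0, 1)) (a - (0, 1))) • bracket (bracket y z) x +
      sgn k (dot (c - (0, 1)) (b - (0, 1))) • bracket (bracket z x) y = 0
  bracket_leibniz : ∀ {a b c x y z}, x ∈ gH a → y ∈ gH b → z ∈ gH c →
    bracket (cup x y) z = cup x (bracket y z) + sgn k (dot a b) • cup y (bracket x z)
  iota_mem : ∀ {a b x m}, x ∈ gH a → m ∈ gM b → iota x m ∈ gM (b - a)
  iota_one : ∀ m, iota one m = m
  iota_cup : ∀ x y m, iota (cup x y) m = iota x (iota y m)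
  d_mem : ∀ {a m}, m ∈ gM a → d m ∈ gM (a + (0, 1))
  d_d : ∀ m, d (d m) = 0
  /-- `ι_{[x, y]} = L_x ι_y - (-1)^{p(y) p(x) + w(y) (w(x) + 1)} ι_y L_x`, where
  `L_x = ι_x d - (-1)^{w(x)} d ι_x` -/
  iota_bracket : ∀ {a b x y}, x ∈ gH a → y ∈ gH b →
    let L : M →ₗ[k] M := iota x ∘ₗ d - sgn k a.2 • (d ∘ₗ iota x)
    iota (bracket x y) = L ∘ₗ iota y - sgn k (b.1 * a.1 + b.2 * (a.2 + 1)) • (iota y ∘ₗ L)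

namespace DifferentialCalculus

variable {k : Type*} [CommRing k]

/-- An isomorphism of differential calculi. -/
structure Iso {H M H' M' : Type*}
    [AddCommGroup H] [Module k H] [AddCommGroup M] [Module k M]
    [AddCommGroup H'] [Module k H'] [AddCommGroup M'] [Module k M']
    {gH : ℤ × ℤ → Submodule k H} {gM : ℤ × ℤ → Submodule k M}
    {gH' : ℤ × ℤ → Submodule k H'} {gM' : ℤ × ℤ → Submodule k M'}
    (D : DifferentialCalculus k gH gM) (D' : DifferentialCalculus k gH' gM') where
  left : H ≃ₗ[k] H'
  right : M ≃ₗ[k] M'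
  map_left : ∀ a, (gH a).map left.toLinearMap = gH' a
  map_right : ∀ a, (gM a).map right.toLinearMap = gM' a
  map_one : left D.one = D'.one
  map_cup : ∀ x y, left (D.cup x y) = D'.cup (left x) (left y)
  map_bracket : ∀ x y, left (D.bracket x y) = D'.bracket (left x) (left y)
  map_iota : ∀ x m, right (D.iota x m) = D'.iota (left x) (right m)
  map_d : ∀ m, right (D.d m) = D'.d (right m)

variable {I : Type*} [Fintype I] [DecidableEq I] {deg : I → ℤ × ℤ} {π : Polyvector k deg}

/-- The operations of a differential calculus on `(HP, H̃P)` are induced by the wedge product,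
the Schouten-Nijenhuis bracket, the mixed contraction and `d̃` on representatives. -/
structure IsInduced (D : DifferentialCalculus k (HP.grading deg π) (MixedHP.grading deg π)) :
    Prop where
  one : ∃ h, D.one = HP.cls deg π ⟨1, h⟩
  cup : ∀ P Q : LinearMap.ker (coboundary deg π), ∃ h,
    D.cup (HP.cls deg π P) (HP.cls deg π Q) = HP.cls deg π ⟨P.1 * Q.1, h⟩
  bracket : ∀ P Q : LinearMap.ker (coboundary deg π), ∃ h,
    D.bracket (HP.cls deg π P) (HP.cls deg π Q) = HP.cls deg π ⟨schouten deg P.1 Q.1, h⟩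
  iota : ∀ (P : LinearMap.ker (coboundary deg π)) (ω : LinearMap.ker (boundary deg π)), ∃ h,
    D.iota (HP.cls deg π P) (MixedHP.cls deg π ω) = MixedHP.cls deg π ⟨contract deg P.1 ω.1, h⟩
  d : ∀ ω : LinearMap.ker (boundary deg π), ∃ h,
    D.d (MixedHP.cls deg π ω) = MixedHP.cls deg π ⟨mixedD deg ω.1, h⟩

end DifferentialCalculus

/-! ### The spaces `k^{m||n}` and `k^{n∧m}` and their Koszul duality -/

section Koszul

variable (k : Type*) [CommRing k] (m n : ℕ)

/-- The coordinates of `k^{m||n}`: `x_i = z_{inl i}` of bidegree `(0, 0)` and `y_j = z_{inr j}` of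
bidegree `(1, 0)`. -/
def degA : Fin m ⊕ Fin n → ℤ × ℤ := Sum.elim (fun _ => (0, 0)) (fun _ => (1, 0))

/-- The coordinates of `k^{n∧m}`: `ξ_i = z_{inl i}` of bidegree `(0, -1)` and `η_j = z_{inr j}` of
bidegree `(-1, -1)`. -/
def degDual : Fin m ⊕ Fin n → ℤ × ℤ := Sum.elim (fun _ => (0, -1)) (fun _ => (-1, -1))

/-- The correspondence of the polyvectors on generators:
`x_i ↦ -∂_{ξ_i}`, `y_j ↦ ∂_{η_j}`, `∂_{x_i} ↦ ξ_i`, `∂_{y_j} ↦ η_j`. -/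
def dualPolyGen : (Fin m ⊕ Fin n) ⊕ (Fin m ⊕ Fin n) → Polyvector k (degDual m n)
  | Sum.inl (Sum.inl i) => -vect (degDual m n) (Sum.inl i)
  | Sum.inl (Sum.inr j) => vect (degDual m n) (Sum.inr j)
  | Sum.inr (Sum.inl i) => coord (degDual m n) (Sum.inl i)
  | Sum.inr (Sum.inr j) => coord (degDual m n) (Sum.inr j)

/-- The correspondence of the mixed differential forms on generators:
`x_i ↦ -∂_{ξ_i}`, `∂_{y_j} ↦ η_j`, `dx_i ↦ ξ_i^*`, `y_j^* ↦ dη_j`. Here `Sum.inl` lists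
`x_i, ∂_{y_j}`, respectively `∂_{ξ_i}, η_j`, and `Sum.inr` lists `dx_i, y_j^*`, respectively
`ξ_i^*, dη_j`. -/
def dualFormGen : (Fin m ⊕ Fin n) ⊕ (Fin m ⊕ Fin n) → MixedForm k (degDual m n)
  | Sum.inl (Sum.inl i) => -gen (formDeg (degDual m n)) (Sum.inl (Sum.inl i))
  | Sum.inl (Sum.inr j) => gen (formDeg (degDual m n)) (Sum.inl (Sum.inr j))
  | Sum.inr (Sum.inl i) => gen (formDeg (degDual m n)) (Sum.inr (Sum.inl i))
  | Sum.inr (Sum.inr j) => gen (formDeg (degDual m n)) (Sum.inr (Sum.inr j))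

/-- The correspondence `Ψ` of the polyvectors on `k^{m||n}` and `k^{n∧m}`. -/
def dualPoly : Polyvector k (degA m n) →ₐ[k] Polyvector k (degDual m n) :=
  lift (dualPolyGen k m n) <| by
    rintro ((i | i) | (i | i)) ((j | j) | (j | j)) <;>
      simp only [dualPolyGen, coord, vect, neg_mul, mul_neg, neg_neg, smul_neg] <;>
      rw [gen_mul_gen] <;> rfl

/-- The correspondence `Φ` of the mixed differential forms on `k^{m||n}` and `k^{n∧m}`. -/
def dualForm : MixedForm k (degA m n) →ₐ[k] MixedForm k (degDual m n) :=
  lift (dualFormGen k m n) <| by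
    rintro ((i | i) | (i | i)) ((j | j) | (j | j)) <;>
      simp only [dualFormGen, neg_mul, mul_neg, neg_neg, smul_neg] <;>
      rw [gen_mul_gen] <;> rfl

variable {k m n}

/-- The Poisson structures `π` on `k^{m||n}` and `π'` on `k^{n∧m}` are Koszul dual: they are
quadratic and correspond to each other under `Ψ`. -/
def IsKoszulDual (π : Polyvector k (degA m n)) (π' : Polyvector k (degDual m n)) : Prop :=
  π ∈ quadraticBivectors k (degA m n) ∧ π' = dualPoly k m n π

/-- An isomorphism of the differential calculi of `k^{m||n}` and `k^{n∧m}` that is induced by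
`Ψ` and `Φ`. -/
structure DifferentialCalculus.Iso.IsInduced
    {π : Polyvector k (degA m n)} {π' : Polyvector k (degDual m n)}
    {D : DifferentialCalculus k (HP.grading (degA m n) π) (MixedHP.grading (degA m n) π)}
    {D' : DifferentialCalculus k (HP.grading (degDual m n) π') (MixedHP.grading (degDual m n) π')}
    (e : D.Iso D') : Prop where
  left : ∀ P : LinearMap.ker (coboundary (degA m n) π), ∃ h,
    e.left (HP.cls _ π P) = HP.cls _ π' ⟨dualPoly k m n P.1, h⟩
  right : ∀ ω : LinearMap.ker (boundary (degA m n) π), ∃ h,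
    e.right (MixedHP.cls _ π ω) = MixedHP.cls _ π' ⟨dualForm k m n ω.1, h⟩

end Koszul

end BiGraded

namespace BiGraded

open BiSym

/-! ### Signs -/

section Sign

variable {k : Type*} [CommRing k]

theorem sgn_neg (a : ℤ) : sgn k (-a) = sgn k a :=
  sgn_congr ⟨-a, by ring⟩

theorem sgn_eq_or (a : ℤ) : sgn k a = 1 ∨ sgn k a = -1 := by
  rcases Int.even_or_odd a with h | h
  · exact Or.inl (by simp [sgn, Int.negOnePow_even a h])
  · exact Or.inr (by simp [sgn, Int.negOnePow_odd a h])

theorem dot_neg_right (a b : ℤ × ℤ) : dot a (-b) = -dot a b := by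
  rw [dot_comm, dot_neg_left, dot_comm]

theorem dot_add_right (a b c : ℤ × ℤ) : dot a (b + c) = dot a b + dot a c := by
  rw [dot_comm, dot_add_left, dot_comm b, dot_comm c]

theorem dot_zero_left (a : ℤ × ℤ) : dot 0 a = 0 := by simp [dot]

theorem dot_zero_right (a : ℤ × ℤ) : dot a 0 = 0 := by simp [dot]

theorem sgn_dot_weight : sgn k (dot (0, 1) (0, 1)) = -1 := by simp [dot, sgn]

theorem sgn_dot_bivector (a : ℤ × ℤ) : sgn k (dot a (0, -2)) = 1 :=
  (sgn_congr (by simp [dot])).trans sgn_zero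

theorem sgn_snd (a : ℤ × ℤ) : sgn k a.2 = sgn k (dot a (0, 1)) := by simp [dot]

theorem sgn_fst (a : ℤ × ℤ) :
    sgn k a.1 = sgn k (dot a a) * sgn k (dot a (0, 1)) := by
  rw [← sgn_add]
  apply sgn_congr
  simp only [dot, Int.even_sub, Int.even_add, Int.even_mul]
  by_cases h1 : Even a.1 <;> by_cases h2 : Even a.2 <;> simp [h1, h2]

end Sign

namespace BiSym

variable {k : Type*} [CommRing k] {I : Type*} {deg : I → ℤ × ℤ}

/-! ### The grading of the symmetric algebra -/

theorem gen_mem_gr (i : I) : (gen deg i : BiSym k deg) ∈ gr k deg (deg i) :=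
  Submodule.subset_span ⟨[i], by simp, by simp⟩

theorem one_mem_gr : (1 : BiSym k deg) ∈ gr k deg 0 :=
  Submodule.subset_span ⟨[], by simp, by simp⟩

theorem mul_mem_gr {a b : ℤ × ℤ} {x y : BiSym k deg} (hx : x ∈ gr k deg a) (hy : y ∈ gr k deg b) :
    x * y ∈ gr k deg (a + b) := by
  have h : gr k deg a * gr k deg b ≤ gr k deg (a + b) := by
    rw [gr, gr, Submodule.span_mul_span, gr]
    apply Submodule.span_mono
    rintro _ ⟨_, ⟨l, rfl, rfl⟩, _, ⟨l', rfl, rfl⟩, rfl⟩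
    exact ⟨l ++ l', by simp, by simp⟩
  exact h (Submodule.mul_mem_mul hx hy)

instance : SetLike.GradedMonoid (gr k deg) where
  one_mem := one_mem_gr
  mul_mem _ _ _ _ hx hy := mul_mem_gr hx hy

theorem mem_gr_congr {a b : ℤ × ℤ} {x : BiSym k deg} (hx : x ∈ gr k deg a) (h : a = b) :
    x ∈ gr k deg b := h ▸ hx

/-- Induction on homogeneous elements by left multiplication with generators. -/
theorem gr_induction {P : ∀ (a : ℤ × ℤ) (x : BiSym k deg), x ∈ gr k deg a → Prop}
    (zero : ∀ a, P a 0 (zero_mem _)) (one : P 0 1 one_mem_gr)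
    (gen_mul : ∀ i a x hx, P a x hx → P (deg i + a) (gen deg i * x) (mul_mem_gr (gen_mem_gr i) hx))
    (add : ∀ a x y hx hy, P a x hx → P a y hy → P a (x + y) (add_mem hx hy))
    (smul : ∀ a (c : k) x hx, P a x hx → P a (c • x) (Submodule.smul_mem _ c hx))
    {a : ℤ × ℤ} {x : BiSym k deg} (hx : x ∈ gr k deg a) : P a x hx := by
  have key : ∀ l : List I, ∃ h : (l.map (gen deg)).prod ∈ gr k deg (l.map deg).sum,
      P (l.map deg).sum (l.map (gen deg)).prod h := by
    intro l
    induction l with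
    | nil => exact ⟨one_mem_gr, one⟩
    | cons i l ih =>
      obtain ⟨h1, h2⟩ := ih
      exact ⟨mul_mem_gr (gen_mem_gr i) h1, gen_mul _ _ _ h1 h2⟩
  induction hx using Submodule.span_induction with
  | mem x h => obtain ⟨l, rfl, rfl⟩ := h; exact (key l).2
  | zero => exact zero _
  | add _ _ h1 h2 h3 h4 => exact add _ _ _ h1 h2 h3 h4
  | smul _ _ h1 h2 => exact smul _ _ _ h1 h2

theorem algHom_ext {B : Type*} [Semiring B] [Algebra k B] {f g : BiSym k deg →ₐ[k] B}
    (h : ∀ i, f (gen deg i) = g (gen deg i)) : f = g := by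
  ext x
  induction x using BiSym.induction with
  | hs r => simp
  | hg i => exact h i
  | hm a b ha hb => simp [ha, hb]
  | ha a b ha hb => simp [ha, hb]

/-- The decomposition of an element into its homogeneous components. -/
def decomposeHom (deg : I → ℤ × ℤ) : BiSym k deg →ₐ[k] DirectSum (ℤ × ℤ) fun d => gr k deg d :=
  lift (fun i => DirectSum.of (fun d => gr k deg d) (deg i) ⟨gen deg i, gen_mem_gr i⟩)
    fun i j => by
      simp only [DirectSum.of_mul_of]
      rw [← DirectSum.lof_eq_of k, ← DirectSum.lof_eq_of k, ← map_smul]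
      simp only [DirectSum.lof_eq_of]
      exact DirectSum.of_eq_of_gradedMonoid_eq
        (Sigma.subtype_ext (add_comm _ _) (gen_mul_gen i j))

instance : GradedAlgebra (gr k deg) :=
  GradedAlgebra.ofAlgHom _ (decomposeHom deg)
    (algHom_ext fun i => by simp [decomposeHom])
    (by
      rintro a ⟨x, hx⟩
      induction hx using gr_induction with
      | zero a =>
        rw [map_zero]
        exact (map_zero (DirectSum.of (fun d => gr k deg d) a)).symm
      | one =>
        rw [map_one]
        rfl
      | gen_mul i a x hx ih =>
        rw [map_mul, ih, decomposeHom, lift_gen, DirectSum.of_mul_of]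
        rfl
      | add a x y hx hy ihx ihy =>
        rw [map_add, ihx, ihy, ← map_add]
        rfl
      | smul a c x hx ih =>
        rw [map_smul, ih, ← DirectSum.lof_eq_of k, ← map_smul]
        rfl)

/-- An additive statement holds if it holds for homogeneous elements. -/
theorem homogeneous_induction {P : BiSym k deg → Prop}
    (add : ∀ x y, P x → P y → P (x + y)) (hom : ∀ a, ∀ x ∈ gr k deg a, P x)
    (x : BiSym k deg) : P x := by
  induction x using DirectSum.Decomposition.inductionOn (gr k deg) with
  | zero => exact hom 0 0 (zero_mem _)
  | homogeneous x => exact hom _ _ x.2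
  | add x y hx hy => exact add x y hx hy

theorem linearMap_ext {V : Type*} [AddCommGroup V] [Module k V] {f g : BiSym k deg →ₗ[k] V}
    (h : ∀ a, ∀ x ∈ gr k deg a, f x = g x) (x : BiSym k deg) : f x = g x := by
  induction x using homogeneous_induction with
  | add x y hx hy => rw [map_add, map_add, hx, hy]
  | hom a x hx => exact h a x hx

theorem map_mem_gr {J : Type*} {deg' : J → ℤ × ℤ} (f : BiSym k deg →ₗ[k] BiSym k deg') {c : ℤ × ℤ}
    (one : f 1 ∈ gr k deg' c)
    (gen_mul : ∀ i a x, x ∈ gr k deg a → f x ∈ gr k deg' (a + c) →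
      f (gen deg i * x) ∈ gr k deg' (deg i + a + c))
    {a : ℤ × ℤ} {x : BiSym k deg} (hx : x ∈ gr k deg a) : f x ∈ gr k deg' (a + c) := by
  induction hx using gr_induction with
  | zero a => simp
  | one => simpa using one
  | gen_mul i a x hx h => exact gen_mul i a x hx h
  | add a x y hx hy h1 h2 => rw [map_add]; exact add_mem h1 h2
  | smul a c x hx h => rw [map_smul]; exact Submodule.smul_mem _ _ h

theorem twist_of_mem (c : ℤ × ℤ) {a : ℤ × ℤ} {x : BiSym k deg} (hx : x ∈ gr k deg a) :
    twist c x = sgn k (dot c a) • x := by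
  induction hx using gr_induction with
  | zero a => simp
  | one => simp [dot_zero_right, sgn_zero]
  | gen_mul i a x hx h =>
    rw [map_mul, twist_gen, h, dot_add_right, sgn_add, smul_mul_smul_comm]
  | add a x y hx hy h1 h2 => rw [map_add, h1, h2, smul_add]
  | smul a r x hx h => rw [map_smul, h, smul_comm]

theorem gen_mul_comm (i : I) {a : ℤ × ℤ} {x : BiSym k deg} (hx : x ∈ gr k deg a) :
    gen deg i * x = sgn k (dot (deg i) a) • (x * gen deg i) := by
  induction hx using gr_induction with
  | zero a => simp
  | one => simp [dot_zero_right, sgn_zero]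
  | gen_mul j a x hx h =>
    rw [← mul_assoc, gen_mul_gen, smul_mul_assoc, mul_assoc, h, mul_smul_comm, smul_smul,
      ← sgn_add, ← dot_add_right, mul_assoc]
  | add a x y hx hy h1 h2 => rw [mul_add, add_mul, h1, h2, smul_add]
  | smul a r x hx h => rw [mul_smul_comm, smul_mul_assoc, h, smul_comm]

/-- Bi-graded commutativity. -/
theorem mul_comm_of_mem {a b : ℤ × ℤ} {x y : BiSym k deg} (hx : x ∈ gr k deg a)
    (hy : y ∈ gr k deg b) : x * y = sgn k (dot a b) • (y * x) := by
  induction hx using gr_induction with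
  | zero a => simp
  | one => simp [dot_zero_left, sgn_zero]
  | gen_mul j a x hx h =>
    rw [mul_assoc, h, mul_smul_comm, ← mul_assoc, gen_mul_comm j hy, smul_mul_assoc, smul_smul,
      ← sgn_add, mul_assoc, ← dot_add_left, add_comm]
  | add a x z hx hz h1 h2 => rw [mul_add, add_mul, h1, h2, smul_add]
  | smul a r x hx h => rw [mul_smul_comm, smul_mul_assoc, h, smul_comm]

/-! ### Derivations -/

theorem leftDer_mul_of_mem (c : ℤ × ℤ) (v : I → BiSym k deg) (hv : Compatible c v)
    {a : ℤ × ℤ} {x : BiSym k deg} (hx : x ∈ gr k deg a) (y : BiSym k deg) :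
    leftDer c v hv (x * y) = leftDer c v hv x * y + sgn k (dot c a) • (x * leftDer c v hv y) := by
  rw [leftDer_mul, twist_of_mem c hx, smul_mul_assoc]

theorem leftDer_one (c : ℤ × ℤ) (v : I → BiSym k deg) (hv : Compatible c v) :
    leftDer c v hv 1 = 0 := by
  simpa using leftDer_algebraMap c v hv 1

theorem leftDer_mem {c : ℤ × ℤ} {v : I → BiSym k deg} (hv : Compatible c v)
    (h : ∀ i, v i ∈ gr k deg (deg i + c)) {a : ℤ × ℤ} {x : BiSym k deg} (hx : x ∈ gr k deg a) :
    leftDer c v hv x ∈ gr k deg (a + c) := by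
  refine map_mem_gr _ (by simp [leftDer_one]) ?_ hx
  intro i a x hx hm
  rw [leftDer_mul_of_mem c v hv (gen_mem_gr i), leftDer_gen]
  exact add_mem (mem_gr_congr (mul_mem_gr (h i) hx) (by abel))
    (Submodule.smul_mem _ _ (mem_gr_congr (mul_mem_gr (gen_mem_gr i) hm) (by abel)))

theorem rightDerHom_apply (c : ℤ × ℤ) (v : I → BiSym k deg) (hv : Compatible c v)
    (x : BiSym k deg) : rightDerHom c v hv x 1 0 = 0 ∧ rightDerHom c v hv x 0 0 = x ∧
      rightDerHom c v hv x 1 1 = twist c x := by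
  induction x using BiSym.induction with
  | hs r => simp [Matrix.algebraMap_matrix_apply]
  | hg i => simp [rightDerHom]
  | hm a b ha hb => simp [Matrix.mul_apply, Fin.sum_univ_two, ha, hb]
  | ha a b ha hb => simp [ha, hb]

theorem rightDer_mul (c : ℤ × ℤ) (v : I → BiSym k deg) (hv : Compatible c v)
    (x y : BiSym k deg) :
    rightDer c v hv (x * y) = x * rightDer c v hv y + rightDer c v hv x * twist c y := by
  simp [rightDer, Matrix.mul_apply, Fin.sum_univ_two, rightDerHom_apply]

theorem rightDer_gen (c : ℤ × ℤ) (v : I → BiSym k deg) (hv : Compatible c v) (i : I) :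
    rightDer c v hv (gen deg i) = v i := by
  simp [rightDer, rightDerHom]

theorem rightDer_one (c : ℤ × ℤ) (v : I → BiSym k deg) (hv : Compatible c v) :
    rightDer c v hv 1 = 0 := by
  have h := rightDer_mul c v hv 1 1
  simpa using h

section Partial

variable [DecidableEq I]

theorem leftPartial_one (i : I) : leftPartial deg i (1 : BiSym k deg) = 0 := leftDer_one _ _ _

theorem leftPartial_gen (i j : I) :
    leftPartial deg i (gen deg j : BiSym k deg) = if j = i then 1 else 0 := leftDer_gen _ _ _ _

theorem leftPartial_mul_of_mem (i : I) {a : ℤ × ℤ} {x : BiSym k deg} (hx : x ∈ gr k deg a)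
    (y : BiSym k deg) : leftPartial deg i (x * y) =
      leftPartial deg i x * y + sgn k (dot (deg i) a) • (x * leftPartial deg i y) := by
  rw [leftPartial, leftDer_mul_of_mem _ _ _ hx, dot_neg_left, sgn_neg]

theorem leftPartial_mem (i : I) {a : ℤ × ℤ} {x : BiSym k deg} (hx : x ∈ gr k deg a) :
    leftPartial deg i x ∈ gr k deg (a - deg i) := by
  rw [sub_eq_add_neg]
  refine leftDer_mem _ (fun j => ?_) hx
  split_ifs with h
  · subst h
    simpa using one_mem_gr
  · exact zero_mem _

/-- The right partial derivative in terms of the left one. -/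
theorem rightPartial_of_mem (i : I) {a : ℤ × ℤ} {x : BiSym k deg} (hx : x ∈ gr k deg a) :
    rightPartial deg i x = sgn k (dot (deg i) (a + deg i)) • leftPartial deg i x := by
  induction hx using gr_induction with
  | zero a => simp
  | one => rw [rightPartial, rightDer_one, leftPartial_one, smul_zero]
  | gen_mul j a x hx h =>
    rw [leftPartial_gen_mul, rightPartial, rightDer_mul, rightDer_gen, ← rightPartial, h,
      twist_of_mem _ hx]
    simp only [dot_add_right, dot_neg_left, sgn_neg, sgn_add, smul_add, mul_smul_comm]
    rw [add_comm, smul_smul]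
    congr 1
    · split_ifs with hj
      · subst hj
        rw [one_mul, mul_right_comm, sgn_mul_self, one_mul]
      · simp
    · rw [mul_right_comm, mul_right_comm _ (sgn k (dot (deg i) a)), sgn_mul_self, one_mul]
  | add a x z hx hz h1 h2 => rw [map_add, map_add, h1, h2, smul_add]
  | smul a r x hx h => rw [map_smul, map_smul, h, smul_comm]

theorem rightPartial_mem (i : I) {a : ℤ × ℤ} {x : BiSym k deg} (hx : x ∈ gr k deg a) :
    rightPartial deg i x ∈ gr k deg (a - deg i) := by
  rw [rightPartial_of_mem i hx]
  exact Submodule.smul_mem _ _ (leftPartial_mem i hx)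

end Partial

end BiSym

/-! ### The Schouten-Nijenhuis bracket -/

section Schouten

variable {k : Type*} [CommRing k] {I : Type*} {deg : I → ℤ × ℤ}

theorem polyDeg_inr (i : I) : polyDeg deg (Sum.inr i) = -polyDeg deg (Sum.inl i) + (0, -1) := rfl

theorem polyDeg_inl (i : I) : polyDeg deg (Sum.inl i) = -polyDeg deg (Sum.inr i) + (0, -1) := by
  rw [polyDeg_inr]
  abel

variable [DecidableEq I]

theorem partial_mul_partial_mul {u v : I ⊕ I} (huv : polyDeg deg v = -polyDeg deg u + (0, -1))
    {a b : ℤ × ℤ} {P Q : Polyvector k deg} (hP : P ∈ gr k (polyDeg deg) a)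
    (hQ : Q ∈ gr k (polyDeg deg) b) (S : Polyvector k deg) :
    rightPartial (polyDeg deg) u P * leftPartial (polyDeg deg) v (Q * S) =
      rightPartial (polyDeg deg) u P * leftPartial (polyDeg deg) v Q * S +
        sgn k (dot b (a + (0, 1))) •
          (Q * (rightPartial (polyDeg deg) u P * leftPartial (polyDeg deg) v S)) := by
  have he : ((0, -1) : ℤ × ℤ) = -(0, 1) := by simp
  rw [leftPartial_mul_of_mem v hQ, mul_add, ← mul_assoc, mul_smul_comm, ← mul_assoc, ← mul_assoc,
    mul_comm_of_mem (rightPartial_mem u hP) hQ, smul_mul_assoc, smul_smul, huv, he]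
  congr 2
  simp only [dot_add_left, sub_eq_add_neg, dot_neg_left, sgn_add, sgn_neg, dot_comm b]
  rcases sgn_eq_or (k := k) (dot (polyDeg deg u) b) with h | h <;> simp only [h] <;> ring

theorem partial_mul_partial_skew {u v : I ⊕ I} (huv : polyDeg deg v = -polyDeg deg u + (0, -1))
    {a b : ℤ × ℤ} {P Q : Polyvector k deg} (hP : P ∈ gr k (polyDeg deg) a)
    (hQ : Q ∈ gr k (polyDeg deg) b) :
    rightPartial (polyDeg deg) u P * leftPartial (polyDeg deg) v Q =
      (sgn k (dot (a + (0, 1)) (b + (0, 1))) * sgn k (polyDeg deg v).1) •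
        (rightPartial (polyDeg deg) v Q * leftPartial (polyDeg deg) u P) := by
  have he : ((0, -1) : ℤ × ℤ) = -(0, 1) := by simp
  have hu : polyDeg deg u = -polyDeg deg v + -(0, 1) := by rw [huv, he]; abel
  rw [rightPartial_of_mem u hP, rightPartial_of_mem v hQ, smul_mul_assoc, smul_mul_assoc,
    mul_comm_of_mem (leftPartial_mem u hP) (leftPartial_mem v hQ), smul_smul, smul_smul,
    sgn_fst, hu]
  congr 1
  generalize polyDeg deg v = v
  simp only [dot_add_left, dot_add_right, sub_eq_add_neg, dot_neg_left, dot_neg_right,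
    sgn_add, sgn_neg, dot_comm (0, 1) a, dot_comm (0, 1) b, dot_comm (0, 1) v,
    dot_comm v a, dot_comm v b, sgn_dot_weight]
  rcases sgn_eq_or (k := k) (dot a v) with h1 | h1 <;>
  rcases sgn_eq_or (k := k) (dot b v) with h2 | h2 <;>
  rcases sgn_eq_or (k := k) (dot v v) with h3 | h3 <;>
  rcases sgn_eq_or (k := k) (dot v (0, 1)) with h4 | h4 <;>
  rcases sgn_eq_or (k := k) (dot a (0, 1)) with h5 | h5 <;>
  simp only [h1, h2, h3, h4, h5] <;> ring

variable [Fintype I]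

theorem schouten_apply (P Q : Polyvector k deg) : schouten deg P Q = ∑ i,
    (rightPartial (polyDeg deg) (Sum.inr i) P * leftPartial (polyDeg deg) (Sum.inl i) Q -
      sgn k (deg i).1 • (rightPartial (polyDeg deg) (Sum.inl i) P *
        leftPartial (polyDeg deg) (Sum.inr i) Q)) := by
  simp [schouten, LinearMap.sum_apply]

theorem schouten_mem {a b : ℤ × ℤ} {P Q : Polyvector k deg} (hP : P ∈ gr k (polyDeg deg) a)
    (hQ : Q ∈ gr k (polyDeg deg) b) : schouten deg P Q ∈ gr k (polyDeg deg) (a + b + (0, 1)) := by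
  rw [schouten_apply]
  have he : ((0, -1) : ℤ × ℤ) = -(0, 1) := by simp
  refine Submodule.sum_mem _ fun i _ => sub_mem ?_ (Submodule.smul_mem _ _ ?_) <;>
  · refine mem_gr_congr (mul_mem_gr (rightPartial_mem _ hP) (leftPartial_mem _ hQ)) ?_
    rw [polyDeg_inr, he]
    abel

theorem schouten_mul_right {a b : ℤ × ℤ} {P Q : Polyvector k deg} (hP : P ∈ gr k (polyDeg deg) a)
    (hQ : Q ∈ gr k (polyDeg deg) b) (S : Polyvector k deg) :
    schouten deg P (Q * S) = schouten deg P Q * S +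
      sgn k (dot b (a + (0, 1))) • (Q * schouten deg P S) := by
  simp only [schouten_apply, Finset.sum_mul, Finset.mul_sum, Finset.smul_sum,
    ← Finset.sum_add_distrib]
  refine Finset.sum_congr rfl fun i _ => ?_
  rw [partial_mul_partial_mul (polyDeg_inl i) hP hQ, partial_mul_partial_mul (polyDeg_inr i) hP hQ]
  simp only [sub_mul, mul_sub, smul_mul_assoc, mul_smul_comm, smul_add, smul_sub]
  rw [smul_comm (sgn k (deg i).1)]
  abel

theorem schouten_skew {a b : ℤ × ℤ} {P Q : Polyvector k deg} (hP : P ∈ gr k (polyDeg deg) a)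
    (hQ : Q ∈ gr k (polyDeg deg) b) :
    schouten deg P Q =
      -(sgn k (dot (a + (0, 1)) (b + (0, 1))) • schouten deg Q P) := by
  simp only [schouten_apply, Finset.smul_sum, ← Finset.sum_neg_distrib]
  refine Finset.sum_congr rfl fun i _ => ?_
  have h : sgn k (polyDeg deg (Sum.inr i)).1 = sgn k (deg i).1 := by
    simp [polyDeg, sgn_neg]
  have h' : polyDeg deg (Sum.inl i) = deg i := rfl
  rw [partial_mul_partial_skew (polyDeg_inl i) hP hQ, partial_mul_partial_skew (polyDeg_inr i) hP hQ,
    h, h']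
  rcases sgn_eq_or (k := k) (deg i).1 with h1 | h1 <;> rw [h1] <;> module

theorem schouten_mul_left {a b : ℤ × ℤ} {P Q : Polyvector k deg} (hP : P ∈ gr k (polyDeg deg) a)
    (hQ : Q ∈ gr k (polyDeg deg) b) (R : Polyvector k deg) :
    schouten deg (P * Q) R =
      P * schouten deg Q R + sgn k (dot a b) • (Q * schouten deg P R) := by
  induction R using homogeneous_induction with
  | add x y hx hy => simp only [map_add, mul_add, hx, hy, smul_add]; abel
  | hom c R hR =>
    rw [schouten_skew (mul_mem_gr hP hQ) hR, schouten_mul_right hR hP,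
      mul_comm_of_mem (schouten_mem hR hP) hQ, schouten_skew hQ hR, schouten_skew hP hR]
    simp only [mul_neg, mul_smul_comm, smul_add, smul_neg, smul_smul, ← sgn_add]
    rw [neg_add_rev]
    congr 3
    · simp only [dot_add_left, dot_add_right, sgn_add, dot_comm (0, 1) c, sgn_dot_weight]
      rcases sgn_eq_or (k := k) (dot a c) with h1 | h1 <;>
      rcases sgn_eq_or (k := k) (dot a (0, 1)) with h2 | h2 <;>
      simp only [h1, h2] <;> ring
    · simp only [dot_add_left, dot_add_right, sgn_add, dot_comm c b, dot_comm (0, 1) b,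
        dot_comm (0, 1) c, sgn_dot_weight]
      rcases sgn_eq_or (k := k) (dot b c) with h1 | h1 <;>
      rcases sgn_eq_or (k := k) (dot b (0, 1)) with h2 | h2 <;>
      simp only [h1, h2] <;> ring

theorem schouten_one_right (P : Polyvector k deg) : schouten deg P 1 = 0 := by
  simp [schouten_apply, leftPartial_one]

theorem schouten_one_left (P : Polyvector k deg) : schouten deg 1 P = 0 := by
  simp [schouten_apply, rightPartial, rightDer_one]

/-! Values on the generators. -/

theorem schouten_gen_gen (u v : I ⊕ I) :
    schouten (k := k) deg (gen (polyDeg deg) u) (gen (polyDeg deg) v) = ∑ i,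
      ((if u = Sum.inr i then 1 else 0) * (if v = Sum.inl i then 1 else 0) -
      sgn k (deg i).1 • ((if u = Sum.inl i then 1 else 0) * (if v = Sum.inr i then 1 else 0))) := by
  simp only [schouten_apply, leftPartial_gen, rightPartial, rightDer_gen]

theorem schouten_coord_coord (i j : I) : schouten (k := k) deg (gen (polyDeg deg) (Sum.inl i))
    (gen (polyDeg deg) (Sum.inl j)) = 0 := by
  simp [schouten_gen_gen]

theorem schouten_vect_vect (i j : I) : schouten (k := k) deg (gen (polyDeg deg) (Sum.inr i))
    (gen (polyDeg deg) (Sum.inr j)) = 0 := by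
  simp [schouten_gen_gen]

theorem schouten_vect_coord (i j : I) : schouten (k := k) deg (gen (polyDeg deg) (Sum.inr i))
    (gen (polyDeg deg) (Sum.inl j)) = if i = j then 1 else 0 := by
  simp [schouten_gen_gen, eq_comm]

theorem schouten_coord_vect (i j : I) : schouten (k := k) deg (gen (polyDeg deg) (Sum.inl i))
    (gen (polyDeg deg) (Sum.inr j)) = if i = j then -sgn k (deg i).1 • 1 else 0 := by
  rcases eq_or_ne i j with rfl | h
  · simp [schouten_gen_gen]
  · simp [schouten_gen_gen, h]

theorem schouten_gen_gen_scalar (u v : I ⊕ I) : ∃ c : k,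
    schouten (k := k) deg (gen (polyDeg deg) u) (gen (polyDeg deg) v) = c • 1 := by
  rcases u with i | i <;> rcases v with j | j
  · exact ⟨0, by simp [schouten_coord_coord]⟩
  · exact ⟨if i = j then -sgn k (deg i).1 else 0, by rw [schouten_coord_vect]; split_ifs <;> simp⟩
  · exact ⟨if i = j then 1 else 0, by rw [schouten_vect_coord]; split_ifs <;> simp⟩
  · exact ⟨0, by simp [schouten_vect_vect]⟩

/-! The Jacobi identity. -/

/-- The failure of `[P, -]` to be a derivation of the bracket, for `P`, `Q` of bidegrees
`a`, `b`. -/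
def jacobiator (deg : I → ℤ × ℤ) (a b : ℤ × ℤ) (P Q R : Polyvector k deg) : Polyvector k deg :=
  schouten deg P (schouten deg Q R) - schouten deg (schouten deg P Q) R -
    sgn k (dot (a + (0, 1)) (b + (0, 1))) • schouten deg Q (schouten deg P R)

theorem jacobiator_mul {a b c : ℤ × ℤ} {P Q R : Polyvector k deg}
    (hP : P ∈ gr k (polyDeg deg) a) (hQ : Q ∈ gr k (polyDeg deg) b)
    (hR : R ∈ gr k (polyDeg deg) c) (S : Polyvector k deg) :
    jacobiator deg a b P Q (R * S) = jacobiator deg a b P Q R * S +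
      sgn k (dot c (a + b)) • (R * jacobiator deg a b P Q S) := by
  simp only [jacobiator]
  rw [schouten_mul_right hQ hR, schouten_mul_right hP hR, schouten_mul_right (schouten_mem hP hQ) hR]
  simp only [map_add, map_smul]
  rw [schouten_mul_right hP (schouten_mem hQ hR), schouten_mul_right hQ (schouten_mem hP hR),
    schouten_mul_right hP hR, schouten_mul_right hQ hR]
  simp only [sub_mul, mul_sub, smul_sub, smul_add, smul_smul, smul_mul_assoc, mul_smul_comm]
  simp only [dot_add_left, dot_add_right, sgn_add, dot_comm c a, dot_comm c b, dot_comm b a,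
    dot_comm (0, 1) a, dot_comm (0, 1) b, sgn_dot_weight]
  rcases sgn_eq_or (k := k) (dot a b) with h1 | h1 <;>
  rcases sgn_eq_or (k := k) (dot a c) with h2 | h2 <;>
  rcases sgn_eq_or (k := k) (dot b c) with h3 | h3 <;>
  rcases sgn_eq_or (k := k) (dot a (0, 1)) with h4 | h4 <;>
  rcases sgn_eq_or (k := k) (dot b (0, 1)) with h5 | h5 <;>
  rcases sgn_eq_or (k := k) (dot c (0, 1)) with h6 | h6 <;>
  simp only [h1, h2, h3, h4, h5, h6] <;> module

theorem jacobiator_swap {a b : ℤ × ℤ} {P Q : Polyvector k deg}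
    (hP : P ∈ gr k (polyDeg deg) a) (hQ : Q ∈ gr k (polyDeg deg) b) (R : Polyvector k deg) :
    jacobiator deg b a Q P R =
      -(sgn k (dot (a + (0, 1)) (b + (0, 1))) • jacobiator deg a b P Q R) := by
  simp only [jacobiator]
  rw [schouten_skew hQ hP, dot_comm (b + (0, 1))]
  simp only [map_neg, map_smul, LinearMap.neg_apply, LinearMap.smul_apply]
  rcases sgn_eq_or (k := k) (dot (a + (0, 1)) (b + (0, 1))) with h | h <;> rw [h] <;> module

theorem jacobiator_swap_right {a b c : ℤ × ℤ} {P Q R : Polyvector k deg}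
    (hP : P ∈ gr k (polyDeg deg) a) (hQ : Q ∈ gr k (polyDeg deg) b)
    (hR : R ∈ gr k (polyDeg deg) c) :
    jacobiator deg a c P R Q =
      -(sgn k (dot (b + (0, 1)) (c + (0, 1))) • jacobiator deg a b P Q R) := by
  simp only [jacobiator]
  rw [schouten_skew hR hQ, schouten_skew (schouten_mem hP hR) hQ,
    schouten_skew hR (schouten_mem hP hQ)]
  simp only [map_neg, map_smul, smul_sub, smul_neg, smul_smul]
  simp only [dot_add_left, dot_add_right, sgn_add, dot_comm c a, dot_comm c b,
    dot_comm (0, 1) a, dot_comm (0, 1) b, dot_comm (0, 1) c, sgn_dot_weight]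
  rcases sgn_eq_or (k := k) (dot a b) with h1 | h1 <;>
  rcases sgn_eq_or (k := k) (dot a c) with h2 | h2 <;>
  rcases sgn_eq_or (k := k) (dot b c) with h3 | h3 <;>
  rcases sgn_eq_or (k := k) (dot a (0, 1)) with h4 | h4 <;>
  rcases sgn_eq_or (k := k) (dot b (0, 1)) with h5 | h5 <;>
  rcases sgn_eq_or (k := k) (dot c (0, 1)) with h6 | h6 <;>
  simp only [h1, h2, h3, h4, h5, h6] <;> module

theorem jacobiator_eq_zero_of_gen {a b c : ℤ × ℤ} {P Q R : Polyvector k deg}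
    (hP : P ∈ gr k (polyDeg deg) a) (hQ : Q ∈ gr k (polyDeg deg) b)
    (hR : R ∈ gr k (polyDeg deg) c)
    (h : ∀ u, jacobiator deg a b P Q (gen (polyDeg deg) u) = 0) :
    jacobiator deg a b P Q R = 0 := by
  induction hR using gr_induction with
  | zero c => simp [jacobiator]
  | one => simp [jacobiator, schouten_one_right]
  | gen_mul i c R hR ih => rw [jacobiator_mul hP hQ (gen_mem_gr i), h, ih]; simp
  | add c x y hx hy h1 h2 =>
    have : jacobiator deg a b P Q (x + y) =
        jacobiator deg a b P Q x + jacobiator deg a b P Q y := by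
      simp only [jacobiator, map_add, smul_add]
      abel
    rw [this, h1, h2, add_zero]
  | smul c r x hx h1 =>
    have : jacobiator deg a b P Q (r • x) = r • jacobiator deg a b P Q x := by
      simp only [jacobiator, map_smul, smul_sub]
      rw [smul_comm r]
    rw [this, h1, smul_zero]

/-- The Jacobi identity: `[P, -]` is a derivation of the bracket. -/
theorem jacobiator_eq_zero {a b c : ℤ × ℤ} {P Q R : Polyvector k deg}
    (hP : P ∈ gr k (polyDeg deg) a) (hQ : Q ∈ gr k (polyDeg deg) b)
    (hR : R ∈ gr k (polyDeg deg) c) : jacobiator deg a b P Q R = 0 := by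
  have swap : ∀ {a b : ℤ × ℤ} {P Q : Polyvector k deg}, P ∈ gr k (polyDeg deg) a →
      Q ∈ gr k (polyDeg deg) b → ∀ R, jacobiator deg a b P Q R = 0 →
        jacobiator deg b a Q P R = 0 := fun hP hQ R h => by
    rw [jacobiator_swap hP hQ, h, smul_zero, neg_zero]
  have swap' : ∀ {a b c : ℤ × ℤ} {P Q R : Polyvector k deg}, P ∈ gr k (polyDeg deg) a →
      Q ∈ gr k (polyDeg deg) b → R ∈ gr k (polyDeg deg) c → jacobiator deg a b P Q R = 0 →
        jacobiator deg a c P R Q = 0 := fun hP hQ hR h => by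
    rw [jacobiator_swap_right hP hQ hR, h, smul_zero, neg_zero]
  refine jacobiator_eq_zero_of_gen hP hQ hR fun u => swap' hP (gen_mem_gr u) hQ ?_
  refine swap (gen_mem_gr u) hP _ ?_
  refine jacobiator_eq_zero_of_gen (gen_mem_gr u) hP hQ fun v => ?_
  refine swap' (gen_mem_gr u) (gen_mem_gr v) hP ?_
  refine jacobiator_eq_zero_of_gen (gen_mem_gr u) (gen_mem_gr v) hP fun w => ?_
  obtain ⟨r, hr⟩ := schouten_gen_gen_scalar (k := k) (deg := deg) u v
  obtain ⟨s, hs⟩ := schouten_gen_gen_scalar (k := k) (deg := deg) v w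
  obtain ⟨t, ht⟩ := schouten_gen_gen_scalar (k := k) (deg := deg) u w
  simp [jacobiator, hr, hs, ht, schouten_one_left, schouten_one_right]

theorem schouten_jacobi {a b c : ℤ × ℤ} {P Q R : Polyvector k deg}
    (hP : P ∈ gr k (polyDeg deg) a) (hQ : Q ∈ gr k (polyDeg deg) b)
    (hR : R ∈ gr k (polyDeg deg) c) :
    sgn k (dot (a + (0, 1)) (c + (0, 1))) • schouten deg (schouten deg P Q) R +
      sgn k (dot (b + (0, 1)) (a + (0, 1))) • schouten deg (schouten deg Q R) P +
      sgn k (dot (c + (0, 1)) (b + (0, 1))) • schouten deg (schouten deg R P) Q = 0 := by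
  have h := jacobiator_eq_zero hP hQ hR
  rw [jacobiator, sub_sub, sub_eq_zero] at h
  rw [schouten_skew (schouten_mem hQ hR) hP, schouten_skew hR hP, h]
  simp only [map_neg, map_smul, LinearMap.neg_apply, LinearMap.smul_apply]
  rw [schouten_skew (schouten_mem hP hR) hQ]
  simp only [smul_add, smul_neg, smul_smul, neg_neg, neg_add]
  simp only [dot_add_left, dot_add_right, sgn_add, dot_comm c a, dot_comm c b, dot_comm b a,
    dot_comm (0, 1) a, dot_comm (0, 1) b, dot_comm (0, 1) c, sgn_dot_weight]
  rcases sgn_eq_or (k := k) (dot a b) with h1 | h1 <;>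
  rcases sgn_eq_or (k := k) (dot a c) with h2 | h2 <;>
  rcases sgn_eq_or (k := k) (dot b c) with h3 | h3 <;>
  rcases sgn_eq_or (k := k) (dot a (0, 1)) with h4 | h4 <;>
  rcases sgn_eq_or (k := k) (dot b (0, 1)) with h5 | h5 <;>
  rcases sgn_eq_or (k := k) (dot c (0, 1)) with h6 | h6 <;>
  simp only [h1, h2, h3, h4, h5, h6] <;> module

end Schouten

/-! ### Contraction and the Cartan formula -/

section Contract

variable {k : Type*} [CommRing k] {I : Type*} {deg : I → ℤ × ℤ}

theorem formDeg_inr (i : I) : formDeg deg (Sum.inr i) = formDeg deg (Sum.inl i) + (0, 1) := rfl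

/-- The coefficient of `d̃` on the generators. -/
def mixedCoeff (k : Type*) [CommRing k] (deg : I → ℤ × ℤ) (i : I) : k :=
  if IsEven deg i then 1 else sgn k (deg i).2

theorem mixedD_inl (i : I) : mixedD (k := k) deg (gen (formDeg deg) (Sum.inl i)) =
    mixedCoeff k deg i • gen (formDeg deg) (Sum.inr i) := leftDer_gen _ _ _ _

theorem mixedD_inr (i : I) :
    mixedD deg (gen (formDeg deg) (Sum.inr i) : MixedForm k deg) = 0 := leftDer_gen _ _ _ _

theorem mixedD_one : mixedD deg (1 : MixedForm k deg) = 0 := leftDer_one _ _ _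

theorem mixedD_mul {a : ℤ × ℤ} {x : MixedForm k deg} (hx : x ∈ gr k (formDeg deg) a)
    (y : MixedForm k deg) :
    mixedD deg (x * y) = mixedD deg x * y + sgn k (dot (0, 1) a) • (x * mixedD deg y) :=
  leftDer_mul_of_mem _ _ _ hx y

theorem mixedD_mem {a : ℤ × ℤ} {x : MixedForm k deg} (hx : x ∈ gr k (formDeg deg) a) :
    mixedD deg x ∈ gr k (formDeg deg) (a + (0, 1)) := by
  refine leftDer_mem _ ?_ hx
  rintro (i | i)
  · exact Submodule.smul_mem _ _ (gen_mem_gr (Sum.inr i))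
  · exact zero_mem _

theorem mixedD_mixedD (x : MixedForm k deg) : mixedD deg (mixedD deg x) = 0 := by
  suffices h : ∀ a, ∀ x ∈ gr k (formDeg deg) a, (mixedD deg ∘ₗ mixedD deg) x =
      (0 : MixedForm k deg →ₗ[k] MixedForm k deg) x from linearMap_ext h x
  intro a x hx
  rw [LinearMap.comp_apply, LinearMap.zero_apply]
  induction hx using gr_induction with
  | zero a => simp
  | one => rw [mixedD_one, map_zero]
  | gen_mul i a x hx h =>
    have hg : mixedD deg (mixedD deg (gen (formDeg deg) i : MixedForm k deg)) = 0 := by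
      rcases i with i | i
      · rw [mixedD_inl, map_smul, mixedD_inr, smul_zero]
      · rw [mixedD_inr, map_zero]
    rw [mixedD_mul (gen_mem_gr i), map_add, map_smul, mixedD_mul (gen_mem_gr i),
      mixedD_mul (mixedD_mem (gen_mem_gr i)), hg, h, dot_add_right, sgn_add, sgn_dot_weight]
    simp
  | add a x y _ _ h1 h2 => rw [map_add, map_add, h1, h2, add_zero]
  | smul a c x _ h => rw [map_smul, map_smul, h, smul_zero]

/-! The generators that act by multiplication, and those that act by derivatives. -/

/-- The generator of the polyvectors that acts by multiplication. -/
def mulGen (deg : I → ℤ × ℤ) (i : I) : I ⊕ I := if IsEven deg i then Sum.inl i else Sum.inr i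

/-- The generator of the polyvectors that acts by a partial derivative. -/
def derGen (deg : I → ℤ × ℤ) (i : I) : I ⊕ I := if IsEven deg i then Sum.inr i else Sum.inl i

theorem eq_mulGen_or_derGen (deg : I → ℤ × ℤ) (u : I ⊕ I) :
    (∃ i, u = mulGen deg i) ∨ ∃ i, u = derGen deg i := by
  rcases u with i | i <;> by_cases h : IsEven deg i
  · exact Or.inl ⟨i, by simp [mulGen, h]⟩
  · exact Or.inr ⟨i, by simp [derGen, h]⟩
  · exact Or.inr ⟨i, by simp [derGen, h]⟩
  · exact Or.inl ⟨i, by simp [mulGen, h]⟩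

theorem polyDeg_mulGen (i : I) : polyDeg deg (mulGen deg i) = formDeg deg (Sum.inl i) := by
  by_cases h : IsEven deg i <;> simp [polyDeg, formDeg, h, mulGen]

theorem polyDeg_derGen (i : I) : polyDeg deg (derGen deg i) = -formDeg deg (Sum.inr i) := by
  by_cases h : IsEven deg i <;> ext <;> simp [polyDeg, formDeg, h, derGen]
  ring

variable [DecidableEq I]

theorem contract_gen (u : I ⊕ I) :
    contract (k := k) deg (gen (polyDeg deg) u) = contractGen deg u := lift_gen _ _ _

theorem contract_mem {a b : ℤ × ℤ} {P : Polyvector k deg} {ω : MixedForm k deg}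
    (hP : P ∈ gr k (polyDeg deg) a) (hω : ω ∈ gr k (formDeg deg) b) :
    contract deg P ω ∈ gr k (formDeg deg) (a + b) := by
  induction hP using gr_induction with
  | zero a => simp
  | one => simpa using hω
  | gen_mul u a x hx h =>
    rw [map_mul, Module.End.mul_apply, contract_gen]
    rcases contractGen_cases (k := k) deg u with ⟨i, h1, h2⟩ | ⟨i, h1, h2⟩ <;> rw [h1, h2]
    · exact mem_gr_congr (mul_mem_gr (gen_mem_gr _) h) (by abel)
    · exact mem_gr_congr (leftPartial_mem _ h) (by abel)
  | add a x y _ _ h1 h2 => rw [map_add]; exact add_mem h1 h2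
  | smul a c x _ h => rw [map_smul]; exact Submodule.smul_mem _ _ h

/-- The Lie derivative `L_P = [ι̃_P, d̃]` of a polyvector field of bidegree `a`. -/
def lieDer (deg : I → ℤ × ℤ) (a : ℤ × ℤ) (P : Polyvector k deg) :
    Module.End k (MixedForm k deg) :=
  contract deg P * mixedD deg - sgn k (dot a (0, 1)) • (mixedD deg * contract deg P)

theorem lieDer_mul {a b : ℤ × ℤ} (P Q : Polyvector k deg) :
    lieDer deg (a + b) (P * Q) =
      contract deg P * lieDer deg b Q + sgn k (dot b (0, 1)) • (lieDer deg a P * contract deg Q) := by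
  simp only [lieDer, map_mul, mul_sub, sub_mul, smul_sub, mul_smul_comm, smul_mul_assoc, smul_smul,
    dot_add_left, sgn_add, mul_assoc]
  rw [mul_comm (sgn k (dot a (0, 1)))]
  abel

theorem contract_comm {a b : ℤ × ℤ} {P Q : Polyvector k deg}
    (hP : P ∈ gr k (polyDeg deg) a) (hQ : Q ∈ gr k (polyDeg deg) b) :
    contract deg P * contract deg Q = sgn k (dot a b) • (contract deg Q * contract deg P) := by
  rw [← map_mul, mul_comm_of_mem hP hQ, map_smul, map_mul]

theorem contract_mulGen (i : I) : contract (k := k) deg (gen (polyDeg deg) (mulGen deg i)) =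
    LinearMap.mulLeft k (gen (formDeg deg) (Sum.inl i)) := by
  by_cases h : IsEven deg i <;> simp [contract_gen, contractGen, mulGen, h]

theorem contract_derGen (i : I) : contract (k := k) deg (gen (polyDeg deg) (derGen deg i)) =
    leftPartial (formDeg deg) (Sum.inr i) := by
  by_cases h : IsEven deg i <;> simp [contract_gen, contractGen, derGen, h]

theorem lieDer_mulGen (i : I) :
    lieDer (k := k) deg (polyDeg deg (mulGen deg i)) (gen (polyDeg deg) (mulGen deg i)) =
      -(sgn k (dot (formDeg deg (Sum.inl i)) (0, 1)) * mixedCoeff k deg i) •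
        LinearMap.mulLeft k (gen (formDeg deg) (Sum.inr i)) := by
  ext x
  simp only [lieDer, contract_mulGen, polyDeg_mulGen, LinearMap.sub_apply, Module.End.mul_apply,
    LinearMap.smul_apply, LinearMap.mulLeft_apply]
  rw [mixedD_mul (gen_mem_gr _), mixedD_inl, dot_comm (0, 1), smul_add, smul_smul, sgn_mul_self,
    smul_mul_assoc, smul_smul]
  module

theorem leftPartial_mixedD (i : I) (x : MixedForm k deg) :
    leftPartial (formDeg deg) (Sum.inr i) (mixedD deg x) =
      sgn k (dot (formDeg deg (Sum.inr i)) (0, 1)) •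
        mixedD deg (leftPartial (formDeg deg) (Sum.inr i) x) +
      mixedCoeff k deg i • leftPartial (formDeg deg) (Sum.inl i) x := by
  suffices h : ∀ a, ∀ x ∈ gr k (formDeg deg) a,
      (leftPartial (formDeg deg) (Sum.inr i) ∘ₗ mixedD deg) x =
      (sgn k (dot (formDeg deg (Sum.inr i)) (0, 1)) •
          (mixedD deg ∘ₗ leftPartial (formDeg deg) (Sum.inr i)) +
        mixedCoeff k deg i • leftPartial (formDeg deg) (Sum.inl i) :
          MixedForm k deg →ₗ[k] MixedForm k deg) x from linearMap_ext h x
  intro a x hx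
  simp only [LinearMap.comp_apply, LinearMap.add_apply, LinearMap.smul_apply]
  induction hx using gr_induction with
  | zero a => simp
  | one => simp [mixedD_one, leftPartial_one]
  | gen_mul u a x hx h =>
    rw [mixedD_mul (gen_mem_gr u), map_add, map_smul, leftPartial_gen_mul, leftPartial_gen_mul, h,
      map_add, map_smul, mixedD_mul (gen_mem_gr u), leftPartial_gen_mul,
      leftPartial_mul_of_mem _ (mixedD_mem (gen_mem_gr u))]
    rcases u with j | j
    · rw [mixedD_inl, map_smul, leftPartial_gen, formDeg_inr]
      simp only [dot_add_left, dot_add_right, dot_neg_left, sgn_add, sgn_neg, sgn_dot_weight,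
        dot_comm (0, 1) (formDeg deg (Sum.inl j))]
      rcases eq_or_ne j i with rfl | hj
      · simp only [if_true, reduceCtorEq, if_false, map_zero]
        simp only [mul_add, smul_add, smul_mul_assoc, mul_smul_comm, one_mul]
        rcases sgn_eq_or (k := k) (dot (formDeg deg (Sum.inl j)) (0, 1)) with h1 | h1 <;>
        rcases sgn_eq_or (k := k) (dot (formDeg deg (Sum.inl j)) (formDeg deg (Sum.inl j)))
          with h2 | h2 <;>
        simp only [h1, h2] <;> module
      · simp only [Sum.inl.injEq, Sum.inr.injEq, hj, if_false, reduceCtorEq, map_zero]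
        simp only [mul_add, smul_add, smul_mul_assoc, mul_smul_comm, zero_mul]
        rcases sgn_eq_or (k := k) (dot (formDeg deg (Sum.inl j)) (0, 1)) with h1 | h1 <;>
        rcases sgn_eq_or (k := k) (dot (formDeg deg (Sum.inl i)) (0, 1)) with h3 | h3 <;>
        rcases sgn_eq_or (k := k) (dot (formDeg deg (Sum.inl i)) (formDeg deg (Sum.inl j)))
          with h2 | h2 <;>
        simp only [h1, h2, h3] <;> module
    · rw [mixedD_inr]
      simp only [formDeg_inr, dot_add_left, dot_add_right, dot_neg_left, sgn_add, sgn_neg,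
        sgn_dot_weight,
        dot_comm (0, 1) (formDeg deg (Sum.inl j))]
      rcases eq_or_ne j i with rfl | hj
      · simp only [if_true, reduceCtorEq, if_false, map_zero]
        simp only [mul_add, smul_add, mul_smul_comm, zero_mul]
        rcases sgn_eq_or (k := k) (dot (formDeg deg (Sum.inl j)) (0, 1)) with h1 | h1 <;>
        rcases sgn_eq_or (k := k) (dot (formDeg deg (Sum.inl j)) (formDeg deg (Sum.inl j)))
          with h2 | h2 <;>
        simp only [h1, h2] <;> module
      · simp only [Sum.inr.injEq, hj, if_false, reduceCtorEq, map_zero]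
        simp only [mul_add, smul_add, mul_smul_comm, zero_mul]
        rcases sgn_eq_or (k := k) (dot (formDeg deg (Sum.inl j)) (0, 1)) with h1 | h1 <;>
        rcases sgn_eq_or (k := k) (dot (formDeg deg (Sum.inl i)) (0, 1)) with h3 | h3 <;>
        rcases sgn_eq_or (k := k) (dot (formDeg deg (Sum.inl i)) (formDeg deg (Sum.inl j)))
          with h2 | h2 <;>
        simp only [h1, h2, h3] <;> module
  | add a x y _ _ h1 h2 => simp only [map_add, h1, h2, smul_add]; abel
  | smul a c x _ h =>
    simp only [map_smul, h, smul_add]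
    rw [smul_comm c, smul_comm c]

theorem lieDer_derGen (i : I) :
    lieDer (k := k) deg (polyDeg deg (derGen deg i)) (gen (polyDeg deg) (derGen deg i)) =
      mixedCoeff k deg i • leftPartial (formDeg deg) (Sum.inl i) := by
  ext x
  simp only [lieDer, contract_derGen, polyDeg_derGen, LinearMap.sub_apply, Module.End.mul_apply,
    LinearMap.smul_apply]
  rw [leftPartial_mixedD, dot_neg_left, sgn_neg, add_sub_cancel_left]

variable [Fintype I]

theorem schouten_derGen_mulGen (i j : I) : schouten (k := k) deg (gen (polyDeg deg) (derGen deg i))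
    (gen (polyDeg deg) (mulGen deg j)) = if i = j then mixedCoeff k deg i • 1 else 0 := by
  rcases eq_or_ne i j with rfl | hij
  · by_cases h : IsEven deg i
    · simp [derGen, mulGen, mixedCoeff, h, schouten_vect_coord]
    · have h1 : -sgn k (deg i).1 = sgn k (deg i).2 := by
        rw [← neg_one_mul, ← sgn_dot_weight, ← sgn_add]
        refine sgn_congr ?_
        rw [IsEven] at h
        simp only [dot, Int.even_add, Int.even_sub] at h ⊢
        by_cases h1 : Even (deg i).1 <;> by_cases h2 : Even (deg i).2 <;> simp_all
      simp [derGen, mulGen, mixedCoeff, h, schouten_coord_vect, h1]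
  · by_cases h : IsEven deg i <;> by_cases h' : IsEven deg j <;>
      simp [derGen, mulGen, h, h', schouten_vect_coord, schouten_coord_coord, schouten_vect_vect,
        schouten_coord_vect, hij]

theorem schouten_mulGen_mulGen (i j : I) : schouten (k := k) deg
    (gen (polyDeg deg) (mulGen deg i)) (gen (polyDeg deg) (mulGen deg j)) = 0 := by
  by_cases h : IsEven deg i <;> by_cases h' : IsEven deg j <;>
  simp [mulGen, h, h', schouten_vect_coord, schouten_coord_coord, schouten_vect_vect,
        schouten_coord_vect]
  · rintro rfl
    exact absurd h h'
  · rintro rfl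
    exact absurd h' h

theorem schouten_derGen_derGen (i j : I) : schouten (k := k) deg
    (gen (polyDeg deg) (derGen deg i)) (gen (polyDeg deg) (derGen deg j)) = 0 := by
  by_cases h : IsEven deg i <;> by_cases h' : IsEven deg j <;>
  simp [derGen, h, h', schouten_vect_coord, schouten_coord_coord, schouten_vect_vect,
        schouten_coord_vect]
  · rintro rfl
    exact absurd h h'
  · rintro rfl
    exact absurd h' h

theorem contract_schouten_gen (u v : I ⊕ I) :
    contract (k := k) deg (schouten deg (gen (polyDeg deg) u) (gen (polyDeg deg) v)) =
      lieDer deg (polyDeg deg u) (gen (polyDeg deg) u) * contract deg (gen (polyDeg deg) v) -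
        sgn k (dot (polyDeg deg u + (0, 1)) (polyDeg deg v)) •
          (contract deg (gen (polyDeg deg) v) *
            lieDer deg (polyDeg deg u) (gen (polyDeg deg) u)) := by
  rcases eq_mulGen_or_derGen deg u with ⟨i, rfl⟩ | ⟨i, rfl⟩ <;>
  rcases eq_mulGen_or_derGen deg v with ⟨j, rfl⟩ | ⟨j, rfl⟩
  · rw [schouten_mulGen_mulGen, lieDer_mulGen, contract_mulGen, map_zero, polyDeg_mulGen,
      polyDeg_mulGen, ← formDeg_inr]
    ext x
    simp only [LinearMap.sub_apply, LinearMap.zero_apply, Module.End.mul_apply,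
      LinearMap.smul_apply, LinearMap.mulLeft_apply, ← mul_assoc, mul_smul_comm, smul_mul_assoc]
    rw [gen_mul_gen (Sum.inr i), smul_mul_assoc, smul_comm, sub_self]
  · rw [schouten_skew (gen_mem_gr _) (gen_mem_gr _), schouten_derGen_mulGen, lieDer_mulGen,
      contract_derGen, polyDeg_mulGen, polyDeg_derGen, formDeg_inr]
    ext x
    simp only [LinearMap.sub_apply, Module.End.mul_apply, map_neg, map_smul, LinearMap.neg_apply,
      LinearMap.smul_apply, LinearMap.mulLeft_apply]
    rw [leftPartial_gen_mul]
    simp only [formDeg_inr, neg_add, dot_add_left, dot_add_right, dot_neg_left, dot_neg_right,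
      sgn_add, sgn_neg, sgn_dot_weight, dot_comm (0, 1) (formDeg deg (Sum.inl i)),
      dot_comm (0, 1) (formDeg deg (Sum.inl j)),
      dot_comm (formDeg deg (Sum.inl j)) (formDeg deg (Sum.inl i))]
    rcases eq_or_ne i j with rfl | hij
    · simp only [if_true, map_smul, map_one, LinearMap.smul_apply, Module.End.one_apply]
      rcases sgn_eq_or (k := k) (dot (formDeg deg (Sum.inl i)) (0, 1)) with h1 | h1 <;>
      rcases sgn_eq_or (k := k) (dot (formDeg deg (Sum.inl i)) (formDeg deg (Sum.inl i)))
        with h2 | h2 <;>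
      simp only [h1, h2] <;> module
    · simp only [hij, hij.symm, Sum.inr.injEq, if_false, map_zero, LinearMap.zero_apply]
      rcases sgn_eq_or (k := k) (dot (formDeg deg (Sum.inl i)) (0, 1)) with h1 | h1 <;>
      rcases sgn_eq_or (k := k) (dot (formDeg deg (Sum.inl j)) (0, 1)) with h3 | h3 <;>
      rcases sgn_eq_or (k := k) (dot (formDeg deg (Sum.inl i)) (formDeg deg (Sum.inl j)))
        with h2 | h2 <;>
      simp only [h1, h2, h3] <;> module
  · rw [schouten_derGen_mulGen, lieDer_derGen, contract_mulGen, polyDeg_mulGen, polyDeg_derGen,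
      formDeg_inr]
    ext x
    simp only [LinearMap.sub_apply, Module.End.mul_apply,
      LinearMap.smul_apply, LinearMap.mulLeft_apply, mul_smul_comm]
    rw [leftPartial_gen_mul]
    simp only [neg_add_rev, neg_add_cancel_comm, dot_neg_left, sgn_neg, Sum.inl.injEq]
    rcases eq_or_ne i j with rfl | hij
    · simp only [if_true, map_smul, map_one, LinearMap.smul_apply, Module.End.one_apply]
      module
    · simp only [hij, hij.symm, if_false, map_zero, LinearMap.zero_apply]
      module
  · rw [schouten_derGen_derGen, lieDer_derGen, contract_derGen, map_zero, polyDeg_derGen,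
      polyDeg_derGen, formDeg_inr i]
    ext x
    simp only [LinearMap.sub_apply, LinearMap.zero_apply, Module.End.mul_apply,
      LinearMap.smul_apply, map_smul]
    rw [leftPartial_comm (Sum.inl i)]
    simp only [neg_add_rev, neg_add_cancel_comm, dot_neg_left, dot_neg_right, neg_neg]
    rw [smul_comm, sub_self]

theorem contract_schouten_gen_left (u : I ⊕ I) {b : ℤ × ℤ} {Q : Polyvector k deg}
    (hQ : Q ∈ gr k (polyDeg deg) b) :
    contract (k := k) deg (schouten deg (gen (polyDeg deg) u) Q) =
      lieDer deg (polyDeg deg u) (gen (polyDeg deg) u) * contract deg Q -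
        sgn k (dot (polyDeg deg u + (0, 1)) b) •
          (contract deg Q * lieDer deg (polyDeg deg u) (gen (polyDeg deg) u)) := by
  induction hQ using gr_induction with
  | zero a => simp
  | one => simp [schouten_one_right, dot_zero_right, sgn_zero]
  | gen_mul v b Q hQ h =>
    rw [schouten_mul_right (gen_mem_gr u) (gen_mem_gr v), map_add, map_smul, map_mul, map_mul, h,
      contract_schouten_gen, dot_comm (polyDeg deg v), dot_add_right, sgn_add, map_mul]
    simp only [mul_sub, sub_mul, smul_sub, smul_smul, mul_smul_comm, smul_mul_assoc, mul_assoc]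
    module
  | add b x y _ _ h1 h2 => simp only [map_add, h1, h2, mul_add, add_mul, smul_add]; abel
  | smul b c x _ h =>
    simp only [map_smul, h, mul_smul_comm, smul_mul_assoc, smul_sub]
    rw [smul_comm c]

/-- The Cartan formula `ι_{[P, Q]} = [L_P, ι_Q]`. -/
theorem contract_schouten {a b : ℤ × ℤ} {P Q : Polyvector k deg}
    (hP : P ∈ gr k (polyDeg deg) a) (hQ : Q ∈ gr k (polyDeg deg) b) :
    contract (k := k) deg (schouten deg P Q) = lieDer deg a P * contract deg Q -
      sgn k (dot (a + (0, 1)) b) • (contract deg Q * lieDer deg a P) := by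
  induction hP using gr_induction with
  | zero a => simp [lieDer]
  | one => simp [schouten_one_left, lieDer, dot_zero_left, sgn_zero]
  | gen_mul u a P hP h =>
    rw [schouten_mul_left (gen_mem_gr u) hP, mul_comm_of_mem hP (schouten_mem (gen_mem_gr u) hQ),
      map_add, map_smul, map_smul, map_mul, map_mul, h, contract_schouten_gen_left u hQ, lieDer_mul,
      add_mul, mul_add, mul_smul_comm (sgn k (dot a (0, 1))), ← mul_assoc (contract deg Q),
      contract_comm hQ (gen_mem_gr u), smul_mul_assoc (sgn k (dot a (0, 1))),
      mul_assoc (lieDer deg (polyDeg deg u) _), contract_comm hP hQ]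
    simp only [mul_sub, sub_mul, smul_add, smul_sub, smul_smul, mul_smul_comm, smul_mul_assoc,
      mul_assoc]
    generalize polyDeg deg u = c
    simp only [dot_add_left, dot_add_right, sgn_add, dot_comm c a, dot_comm c b,
      dot_comm (0, 1) b]
    rcases sgn_eq_or (k := k) (dot a b) with h1 | h1 <;>
    rcases sgn_eq_or (k := k) (dot a c) with h2 | h2 <;>
    rcases sgn_eq_or (k := k) (dot b c) with h3 | h3 <;>
    rcases sgn_eq_or (k := k) (dot a (0, 1)) with h4 | h4 <;>
    simp only [h1, h2, h3, h4] <;> module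
  | add a x y _ _ h1 h2 =>
    have h : lieDer deg a (x + y) = lieDer deg a x + lieDer deg a y := by
      simp only [lieDer, map_add, add_mul, mul_add, smul_add]
      abel
    simp only [map_add, LinearMap.add_apply, h1, h2, h, mul_add, add_mul, smul_add]
    abel
  | smul a c x _ h =>
    have h' : lieDer deg a (c • x) = c • lieDer deg a x := by
      simp only [lieDer, map_smul, smul_mul_assoc, mul_smul_comm, smul_sub]
      rw [smul_comm c]
    simp only [map_smul, LinearMap.smul_apply, h, h', mul_smul_comm, smul_mul_assoc, smul_sub]
    rw [smul_comm c]

end Contract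

/-! ### Homology of an endomorphism -/

section Homology

variable {k V W U : Type*} [CommRing k] [AddCommGroup V] [Module k V] [AddCommGroup W] [Module k W]
  [AddCommGroup U] [Module k U]

/-- The quotient `ker D / im D`. -/
abbrev Homology (D : V →ₗ[k] V) :=
  LinearMap.ker D ⧸ (LinearMap.range D).submoduleOf (LinearMap.ker D)

/-- The class of a cycle. -/
def Homology.cls (D : V →ₗ[k] V) : LinearMap.ker D →ₗ[k] Homology D := Submodule.mkQ _

theorem Homology.cls_surjective (D : V →ₗ[k] V) : Function.Surjective (Homology.cls D) :=
  Submodule.mkQ_surjective _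

theorem Homology.cls_eq_zero {D : V →ₗ[k] V} (x : LinearMap.ker D) (hx : x.1 ∈ LinearMap.range D) :
    Homology.cls D x = 0 :=
  (Submodule.Quotient.mk_eq_zero _).2 hx

/-- The map on homology induced by a linear map. -/
def homologyMap {D : V →ₗ[k] V} {E : W →ₗ[k] W} (f : V →ₗ[k] W)
    (hker : ∀ x ∈ LinearMap.ker D, f x ∈ LinearMap.ker E)
    (hrange : ∀ x, f (D x) ∈ LinearMap.range E) : Homology D →ₗ[k] Homology E :=
  Submodule.liftQ _ (Homology.cls E ∘ₗ f.restrict hker) <| by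
    rintro ⟨_, _⟩ ⟨x, rfl⟩
    exact Homology.cls_eq_zero _ (hrange x)

theorem homologyMap_cls {D : V →ₗ[k] V} {E : W →ₗ[k] W} (f : V →ₗ[k] W)
    (hker : ∀ x ∈ LinearMap.ker D, f x ∈ LinearMap.ker E)
    (hrange : ∀ x, f (D x) ∈ LinearMap.range E) (x : LinearMap.ker D) :
    homologyMap f hker hrange (Homology.cls D x) = Homology.cls E ⟨f x, hker x.1 x.2⟩ := rfl

/-- The bilinear map on homology induced by a bilinear map. -/
def homologyMap₂ {D : V →ₗ[k] V} {E : W →ₗ[k] W} {F : U →ₗ[k] U} (f : V →ₗ[k] W →ₗ[k] U)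
    (hker : ∀ x ∈ LinearMap.ker D, ∀ y ∈ LinearMap.ker E, f x y ∈ LinearMap.ker F)
    (hleft : ∀ x, ∀ y ∈ LinearMap.ker E, f (D x) y ∈ LinearMap.range F)
    (hright : ∀ x ∈ LinearMap.ker D, ∀ y, f x (E y) ∈ LinearMap.range F) :
    Homology D →ₗ[k] Homology E →ₗ[k] Homology F :=
  LinearMap.liftQ₂ _ _
    (LinearMap.mk₂ k (fun x y => Homology.cls F ⟨f x y, hker x.1 x.2 y.1 y.2⟩)
      (fun x y z => by
        rw [← map_add]
        exact congrArg _ (Subtype.ext (by simp)))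
      (fun c x y => by
        rw [← map_smul]
        exact congrArg _ (Subtype.ext (by simp)))
      (fun x y z => by
        rw [← map_add]
        exact congrArg _ (Subtype.ext (by simp)))
      (fun c x y => by
        rw [← map_smul]
        exact congrArg _ (Subtype.ext (by simp))))
    (by
      rintro ⟨_, _⟩ ⟨x, rfl⟩
      exact LinearMap.ext fun y => Homology.cls_eq_zero _ (hleft x y.1 y.2))
    (by
      rintro ⟨_, _⟩ ⟨y, rfl⟩
      exact LinearMap.ext fun x => Homology.cls_eq_zero _ (hright x.1 x.2 y))

/-- Compatible mutually inverse linear maps induce an isomorphism on homology. -/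
def homologyEquiv {D : V →ₗ[k] V} {E : W →ₗ[k] W} (e : V ≃ₗ[k] W)
    (h : ∀ x, e (D x) = E (e x)) : Homology D ≃ₗ[k] Homology E :=
  have h' : ∀ x, e.symm (E x) = D (e.symm x) := fun x => e.injective (by simp [h])
  LinearEquiv.ofLinearMap
    (homologyMap e.toLinearMap
      (fun x hx => by
        rw [LinearMap.mem_ker] at hx ⊢
        simp [← h, hx])
      (fun x => ⟨e x, (h x).symm⟩))
    (homologyMap e.symm.toLinearMap
      (fun x hx => by
        rw [LinearMap.mem_ker] at hx ⊢
        simp [← h', hx])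
      (fun x => ⟨e.symm x, (h' x).symm⟩))
    (by
      refine LinearMap.ext fun x => ?_
      obtain ⟨x, rfl⟩ := Homology.cls_surjective _ x
      exact congrArg (Homology.cls E) (Subtype.ext (e.apply_symm_apply x.1)))
    (by
      refine LinearMap.ext fun x => ?_
      obtain ⟨x, rfl⟩ := Homology.cls_surjective _ x
      exact congrArg (Homology.cls D) (Subtype.ext (e.symm_apply_apply x.1)))

theorem isInternal_of_projections {ι : Type*} [DecidableEq ι] (A : ι → Submodule k V)
    (q : ι → V →ₗ[k] V) (h : ∀ a, ∀ x ∈ A a, q a x = x) (h' : ∀ a b, b ≠ a → ∀ x ∈ A b, q a x = 0)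
    (htop : ⨆ a, A a = ⊤) : DirectSum.IsInternal A := by
  refine (DirectSum.isInternal_submodule_iff_iSupIndep_and_iSup_eq_top A).2 ⟨fun a => ?_, htop⟩
  rw [Submodule.disjoint_def]
  intro x hx hx'
  have hle : ⨆ b, ⨆ (_ : b ≠ a), A b ≤ LinearMap.ker (q a) :=
    iSup₂_le fun b hb x hx => h' a b hb x hx
  rw [← h a x hx]
  exact hle hx'

/-- The projection to a homogeneous component. -/
def gradedProj {ι : Type*} [DecidableEq ι] (A : ι → Submodule k V) [DirectSum.Decomposition A]
    (a : ι) : V →ₗ[k] V :=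
  (A a).subtype ∘ₗ DirectSum.component k ι (fun a => A a) a ∘ₗ
    (DirectSum.decomposeLinearEquiv A).toLinearMap

theorem gradedProj_apply {ι : Type*} [DecidableEq ι] (A : ι → Submodule k V)
    [DirectSum.Decomposition A] (a : ι) (x : V) :
    gradedProj A a x = (DirectSum.decompose A x a : V) := rfl

/-- The homology of a homogeneous endomorphism of a graded module is graded. -/
theorem isInternal_homology {ι : Type*} [AddGroup ι] [DecidableEq ι] (A : ι → Submodule k V)
    [DirectSum.Decomposition A] (D : V →ₗ[k] V) (c : ι)
    (hD : ∀ a, ∀ x ∈ A a, D x ∈ A (a + c)) (σ : ι ≃ ι) :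
    DirectSum.IsInternal fun a =>
      ((A (σ a)).submoduleOf (LinearMap.ker D)).map (Homology.cls D) := by
  have hp : ∀ a x, gradedProj A (a + c) (D x) = D (gradedProj A a x) := by
    intro a x
    simp only [gradedProj_apply]
    induction x using DirectSum.Decomposition.inductionOn A with
    | zero => simp
    | @homogeneous b x =>
      rcases eq_or_ne b a with rfl | hb
      · rw [DirectSum.decompose_of_mem_same A (hD _ x x.2), DirectSum.decompose_of_mem_same A x.2]
      · rw [DirectSum.decompose_of_mem_ne A (hD _ x x.2) (by simpa using hb),
          DirectSum.decompose_of_mem_ne A x.2 hb, map_zero]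
    | add x y hx hy =>
      simp only [map_add, DirectSum.decompose_add, DirectSum.add_apply, Submodule.coe_add, hx, hy]
  have hker : ∀ a, ∀ x ∈ LinearMap.ker D, gradedProj A a x ∈ LinearMap.ker D := by
    intro a x hx
    rw [LinearMap.mem_ker] at hx ⊢
    rw [← hp, hx, map_zero]
  have hrange : ∀ a x, gradedProj A a (D x) ∈ LinearMap.range D := fun a x =>
    ⟨gradedProj A (a - c) x, by rw [← hp, sub_add_cancel]⟩
  refine isInternal_of_projections _
    (fun a => homologyMap (gradedProj A (σ a)) (hker _) (hrange _)) ?_ ?_ ?_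
  · rintro a _ ⟨x, hx, rfl⟩
    exact congrArg (Homology.cls D) (Subtype.ext (DirectSum.decompose_of_mem_same A hx))
  · rintro a b hb _ ⟨x, hx, rfl⟩
    rw [homologyMap_cls]
    refine (congrArg (Homology.cls D) (Subtype.ext ?_)).trans (map_zero _)
    exact DirectSum.decompose_of_mem_ne A hx (fun h => hb (σ.injective h))
  · classical
    rw [eq_top_iff]
    rintro x -
    obtain ⟨x, rfl⟩ := Homology.cls_surjective _ x
    have hx : x = ∑ a ∈ (DirectSum.decompose A x.1).support,
        (⟨gradedProj A a x, hker a x.1 x.2⟩ : LinearMap.ker D) := by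
      apply Subtype.ext
      rw [AddSubmonoidClass.coe_finsetSum]
      exact (DirectSum.sum_support_decompose A x.1).symm
    rw [hx, map_sum]
    refine Submodule.sum_mem _ fun a _ => ?_
    refine Submodule.mem_iSup_of_mem (σ.symm a) ⟨_, ?_, rfl⟩
    rw [σ.apply_symm_apply]
    exact (DirectSum.decompose A x.1 a).2

end Homology

/-! ### The differential calculus of a Poisson structure -/

namespace BiSym

variable {k : Type*} [CommRing k] {I : Type*} {deg : I → ℤ × ℤ}

theorem twist_twist (c : ℤ × ℤ) (x : BiSym k deg) : twist c (twist c x) = x := by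
  have h : (twist c).comp (twist c) = AlgHom.id k (BiSym k deg) :=
    algHom_ext fun i => by simp [smul_smul, sgn_mul_self]
  exact DFunLike.congr_fun h x

end BiSym

theorem dot_neg_add_weight (a b : ℤ × ℤ) :
    dot (-a + (0, 1)) (-b + (0, 1)) = dot (a - (0, 1)) (b - (0, 1)) := by
  simp only [dot, Prod.fst_add, Prod.snd_add, Prod.fst_neg, Prod.snd_neg, Prod.fst_sub,
    Prod.snd_sub]
  ring

section Calculus

variable {k : Type*} [CommRing k] {I : Type*} {deg : I → ℤ × ℤ} [DecidableEq I]
  {π : Polyvector k deg}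

theorem boundary_eq_lieDer : boundary deg π = lieDer deg (0, -2) π := by
  rw [lieDer, dot_comm, sgn_dot_bivector, one_smul]
  rfl

theorem boundary_mem (hπ : π ∈ gr k (polyDeg deg) (0, -2)) {a : ℤ × ℤ} {ω : MixedForm k deg}
    (hω : ω ∈ gr k (formDeg deg) a) : boundary deg π ω ∈ gr k (formDeg deg) (a + (0, -1)) := by
  refine sub_mem (mem_gr_congr (contract_mem hπ (mixedD_mem hω)) ?_)
    (mem_gr_congr (mixedD_mem (contract_mem hπ hω)) ?_) <;>
  · ext
    · simp
    · simp
      ring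

theorem boundary_mixedD (ω : MixedForm k deg) :
    boundary deg π (mixedD deg ω) = -mixedD deg (boundary deg π ω) := by
  simp [boundary, mixedD_mixedD]

/-- The differential on mixed Poisson homology. -/
def MixedHP.d : MixedHP deg π →ₗ[k] MixedHP deg π :=
  homologyMap (mixedD deg)
    (fun ω hω => by
      rw [LinearMap.mem_ker] at hω ⊢
      rw [boundary_mixedD, hω, map_zero, neg_zero])
    (fun ω => ⟨-mixedD deg ω, by rw [map_neg, boundary_mixedD, neg_neg]⟩)

theorem MixedHP.cls_surjective (ω : MixedHP deg π) : ∃ ω', MixedHP.cls deg π ω' = ω :=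
  Submodule.mkQ_surjective _ ω

theorem MixedHP.cls_congr {P Q : LinearMap.ker (boundary deg π)} (h : P.1 = Q.1) :
    MixedHP.cls deg π P = MixedHP.cls deg π Q := congrArg _ (Subtype.ext h)

variable [Fintype I]

theorem coboundary_apply (P : Polyvector k deg) : coboundary deg π P = schouten deg P π := rfl

theorem coboundary_mem (hπ : π ∈ gr k (polyDeg deg) (0, -2)) {a : ℤ × ℤ} {P : Polyvector k deg}
    (hP : P ∈ gr k (polyDeg deg) a) : coboundary deg π P ∈ gr k (polyDeg deg) (a + (0, -1)) :=
  mem_gr_congr (schouten_mem hP hπ) (by rw [add_assoc]; rfl)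

theorem coboundary_one : coboundary deg π 1 = 0 := schouten_one_left π

theorem sgn_dot_weight_neg (a : ℤ × ℤ) : sgn k (dot a (0, -1)) = sgn k (dot a (0, 1)) := by
  rw [← sgn_neg, ← dot_neg_right]
  simp

theorem coboundary_twist (hπ : π ∈ gr k (polyDeg deg) (0, -2)) (P : Polyvector k deg) :
    coboundary deg π (twist (0, 1) P) = -twist (0, 1) (coboundary deg π P) := by
  induction P using homogeneous_induction with
  | add x y hx hy => simp only [map_add, hx, hy, neg_add]
  | hom a P hP =>
    rw [twist_of_mem _ hP, twist_of_mem _ (coboundary_mem hπ hP), map_smul, dot_add_right, sgn_add,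
      sgn_dot_weight_neg, sgn_dot_weight]
    module

theorem coboundary_mul (hπ : π ∈ gr k (polyDeg deg) (0, -2)) (P Q : Polyvector k deg) :
    coboundary deg π (P * Q) =
      P * coboundary deg π Q + coboundary deg π P * twist (0, 1) Q := by
  induction P using homogeneous_induction with
  | add x y hx hy => simp only [map_add, add_mul, hx, hy]; abel
  | hom a P hP =>
    induction Q using homogeneous_induction with
    | add x y hx hy => simp only [map_add, mul_add, hx, hy]; abel
    | hom b Q hQ =>
      rw [twist_of_mem _ hQ, coboundary_apply, schouten_mul_left hP hQ, ← coboundary_apply,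
        ← coboundary_apply, mul_comm_of_mem hQ (coboundary_mem hπ hP), dot_add_right, sgn_add,
        sgn_dot_weight_neg, smul_smul, ← mul_assoc, dot_comm b a, sgn_mul_self, one_mul,
        dot_comm b, mul_smul_comm]

theorem coboundary_schouten (hπ : π ∈ gr k (polyDeg deg) (0, -2)) (P Q : Polyvector k deg) :
    coboundary deg π (schouten deg P Q) =
      schouten deg P (coboundary deg π Q) - schouten deg (coboundary deg π P) (twist (0, 1) Q) := by
  induction P using homogeneous_induction with
  | add x y hx hy => simp only [map_add, LinearMap.add_apply, hx, hy]; abel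
  | hom a P hP =>
    induction Q using homogeneous_induction with
    | add x y hx hy => simp only [map_add, hx, hy]; abel
    | hom b Q hQ =>
      have h := jacobiator_eq_zero hP hQ hπ
      simp only [jacobiator, ← coboundary_apply (π := π)] at h
      rw [schouten_skew hQ (coboundary_mem hπ hP)] at h
      rw [twist_of_mem _ hQ, map_smul]
      have h2 : ((0, -1) : ℤ × ℤ) + (0, 1) = 0 := rfl
      rw [add_assoc a, h2, add_zero, dot_comm (b + _), dot_add_left, sgn_add, smul_neg, smul_smul,
        mul_right_comm, sgn_mul_self, one_mul, dot_add_right, sgn_add, sgn_dot_weight] at h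
      rw [← sub_eq_zero, ← neg_eq_zero, ← h]
      module

theorem boundary_contract (hπ : π ∈ gr k (polyDeg deg) (0, -2)) (P : Polyvector k deg)
    (ω : MixedForm k deg) :
    boundary deg π (contract deg P ω) = contract deg (twist (0, 1) P) (boundary deg π ω) +
      contract deg (coboundary deg π (twist (0, 1) P)) ω := by
  induction P using homogeneous_induction with
  | add x y hx hy => simp only [map_add, LinearMap.add_apply, hx, hy]; abel
  | hom a P hP =>
    have h := contract_schouten hπ hP
    have h1 : ((0, -2) : ℤ × ℤ) + (0, 1) = (0, -1) := rfl
    rw [schouten_skew hπ hP, h1, ← boundary_eq_lieDer, ← coboundary_apply, dot_comm (0, -1) a,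
      sgn_dot_weight_neg, dot_comm (0, -1), sgn_dot_weight_neg, dot_add_left, sgn_add,
      sgn_dot_weight, dot_comm a] at h
    have h' := LinearMap.congr_fun h ω
    simp only [map_neg, map_smul, LinearMap.neg_apply, LinearMap.smul_apply, LinearMap.sub_apply,
      Module.End.mul_apply] at h'
    rw [twist_of_mem _ hP]
    simp only [map_smul, LinearMap.smul_apply]
    rw [← sub_eq_iff_eq_add', ← h']
    module

theorem boundary_twist_contract (hπ : π ∈ gr k (polyDeg deg) (0, -2)) (P : Polyvector k deg)
    (ω : MixedForm k deg) :
    contract deg (coboundary deg π P) ω =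
      boundary deg π (contract deg (twist (0, 1) P) ω) - contract deg P (boundary deg π ω) := by
  rw [boundary_contract hπ, twist_twist, add_sub_cancel_left]

/-! The operations on homology. -/

theorem twist_mem_ker (hπ : π ∈ gr k (polyDeg deg) (0, -2)) {P : Polyvector k deg}
    (hP : P ∈ LinearMap.ker (coboundary deg π)) :
    twist (0, 1) P ∈ LinearMap.ker (coboundary deg π) := by
  rw [LinearMap.mem_ker] at hP ⊢
  rw [coboundary_twist hπ, hP, map_zero, neg_zero]

/-- The product on Poisson cohomology. -/
def HP.cup (hπ : π ∈ gr k (polyDeg deg) (0, -2)) : HP deg π →ₗ[k] HP deg π →ₗ[k] HP deg π :=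
  homologyMap₂ (LinearMap.mul k (Polyvector k deg))
    (fun P hP Q hQ => by
      rw [LinearMap.mem_ker] at hP hQ ⊢
      rw [LinearMap.mul_apply', coboundary_mul hπ, hP, hQ, mul_zero, zero_mul, add_zero])
    (fun P Q hQ => ⟨P * twist (0, 1) Q, by
      have hQ' := twist_mem_ker hπ hQ
      rw [LinearMap.mem_ker] at hQ'
      rw [coboundary_mul hπ, hQ', twist_twist, mul_zero, zero_add, LinearMap.mul_apply']⟩)
    (fun P hP Q => ⟨P * Q, by
      rw [LinearMap.mem_ker] at hP
      rw [coboundary_mul hπ, hP, zero_mul, add_zero, LinearMap.mul_apply']⟩)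

/-- The bracket on Poisson cohomology. -/
def HP.bracket (hπ : π ∈ gr k (polyDeg deg) (0, -2)) : HP deg π →ₗ[k] HP deg π →ₗ[k] HP deg π :=
  homologyMap₂ (schouten deg)
    (fun P hP Q hQ => by
      rw [LinearMap.mem_ker] at hP hQ ⊢
      rw [coboundary_schouten hπ, hP, hQ, map_zero, map_zero, LinearMap.zero_apply, sub_zero])
    (fun P Q hQ => ⟨-schouten deg P (twist (0, 1) Q), by
      have hQ' := twist_mem_ker hπ hQ
      rw [LinearMap.mem_ker] at hQ'
      rw [map_neg, coboundary_schouten hπ, hQ', twist_twist, map_zero, zero_sub, neg_neg]⟩)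
    (fun P hP Q => ⟨schouten deg P Q, by
      rw [LinearMap.mem_ker] at hP
      rw [coboundary_schouten hπ, hP, map_zero, LinearMap.zero_apply, sub_zero]⟩)

/-- The action of Poisson cohomology on mixed Poisson homology. -/
def HP.iota (hπ : π ∈ gr k (polyDeg deg) (0, -2)) :
    HP deg π →ₗ[k] MixedHP deg π →ₗ[k] MixedHP deg π :=
  homologyMap₂ (contract deg).toLinearMap
    (fun P hP ω hω => by
      have hP' := twist_mem_ker hπ hP
      rw [LinearMap.mem_ker] at hP' hω ⊢
      rw [AlgHom.toLinearMap_apply, boundary_contract hπ, hP', hω, map_zero, map_zero,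
        LinearMap.zero_apply, add_zero])
    (fun P ω hω => ⟨contract deg (twist (0, 1) P) ω, by
      rw [LinearMap.mem_ker] at hω
      rw [AlgHom.toLinearMap_apply, boundary_twist_contract hπ, hω, map_zero, sub_zero]⟩)
    (fun P hP ω => ⟨contract deg (twist (0, 1) P) ω, by
      rw [LinearMap.mem_ker] at hP
      rw [AlgHom.toLinearMap_apply, boundary_contract hπ, twist_twist, hP, map_zero,
        LinearMap.zero_apply, add_zero]⟩)

theorem HP.cls_surjective (P : HP deg π) : ∃ P', HP.cls deg π P' = P :=
  Submodule.mkQ_surjective _ P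

theorem HP.cls_congr {P Q : LinearMap.ker (coboundary deg π)} (h : P.1 = Q.1) :
    HP.cls deg π P = HP.cls deg π Q := congrArg _ (Subtype.ext h)

/-- The differential calculus of Poisson cohomology and mixed Poisson homology. -/
def poissonCalculus (hπ : π ∈ gr k (polyDeg deg) (0, -2)) :
    DifferentialCalculus k (HP.grading deg π) (MixedHP.grading deg π) where
  isInternal_left := isInternal_homology (gr k (polyDeg deg)) (coboundary deg π) (0, -1)
    (fun _ _ hP => coboundary_mem hπ hP) (Equiv.neg _)
  isInternal_right := isInternal_homology (gr k (formDeg deg)) (boundary deg π) (0, -1)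
    (fun _ _ hω => boundary_mem hπ hω) (Equiv.refl _)
  cup := HP.cup hπ
  one := HP.cls deg π ⟨1, coboundary_one⟩
  bracket := HP.bracket hπ
  iota := HP.iota hπ
  d := MixedHP.d
  one_mem := ⟨_, mem_gr_congr one_mem_gr neg_zero.symm, rfl⟩
  cup_mem := by
    rintro a b _ _ ⟨P, hP, rfl⟩ ⟨Q, hQ, rfl⟩
    exact ⟨_, mem_gr_congr (mul_mem_gr hP hQ) (neg_add a b).symm, rfl⟩
  one_cup x := by
    obtain ⟨P, rfl⟩ := HP.cls_surjective x
    exact HP.cls_congr (one_mul P.1)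
  cup_assoc x y z := by
    obtain ⟨P, rfl⟩ := HP.cls_surjective x
    obtain ⟨Q, rfl⟩ := HP.cls_surjective y
    obtain ⟨R, rfl⟩ := HP.cls_surjective z
    exact HP.cls_congr (mul_assoc P.1 Q.1 R.1)
  cup_comm := by
    rintro a b _ _ ⟨P, hP, rfl⟩ ⟨Q, hQ, rfl⟩
    have h := mul_comm_of_mem hP hQ
    rw [dot_neg_left, dot_neg_right, neg_neg] at h
    exact HP.cls_congr h
  bracket_mem := by
    rintro a b _ _ ⟨P, hP, rfl⟩ ⟨Q, hQ, rfl⟩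
    exact ⟨_, mem_gr_congr (schouten_mem hP hQ) (by abel), rfl⟩
  bracket_skew := by
    rintro a b _ _ ⟨P, hP, rfl⟩ ⟨Q, hQ, rfl⟩
    have h := schouten_skew hP hQ
    rw [dot_neg_add_weight] at h
    exact HP.cls_congr h
  bracket_jacobi := by
    rintro a b c _ _ _ ⟨P, hP, rfl⟩ ⟨Q, hQ, rfl⟩ ⟨R, hR, rfl⟩
    have h := schouten_jacobi hP hQ hR
    simp only [dot_neg_add_weight] at h
    exact HP.cls_congr h
  bracket_leibniz := by
    rintro a b c _ _ _ ⟨P, hP, rfl⟩ ⟨Q, hQ, rfl⟩ ⟨R, hR, rfl⟩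
    have h := schouten_mul_left hP hQ R.1
    rw [dot_neg_left, dot_neg_right, neg_neg] at h
    exact HP.cls_congr h
  iota_mem := by
    rintro a b _ _ ⟨P, hP, rfl⟩ ⟨ω, hω, rfl⟩
    exact ⟨_, mem_gr_congr (contract_mem hP hω) (neg_add_eq_sub a b), rfl⟩
  iota_one m := by
    obtain ⟨ω, rfl⟩ := MixedHP.cls_surjective m
    exact MixedHP.cls_congr (by simp)
  iota_cup x y m := by
    obtain ⟨P, rfl⟩ := HP.cls_surjective x
    obtain ⟨Q, rfl⟩ := HP.cls_surjective y
    obtain ⟨ω, rfl⟩ := MixedHP.cls_surjective m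
    exact MixedHP.cls_congr (by simp)
  d_mem := by
    rintro a _ ⟨ω, hω, rfl⟩
    exact ⟨_, mixedD_mem hω, rfl⟩
  d_d m := by
    obtain ⟨ω, rfl⟩ := MixedHP.cls_surjective m
    exact MixedHP.cls_congr (mixedD_mixedD ω.1)
  iota_bracket := by
    rintro a b _ _ ⟨P, hP, rfl⟩ ⟨Q, hQ, rfl⟩
    refine LinearMap.ext fun m => ?_
    obtain ⟨ω, rfl⟩ := MixedHP.cls_surjective m
    have h := LinearMap.congr_fun (contract_schouten hP hQ) ω.1
    have h1 : sgn k (dot (-a + (0, 1)) (-b)) = sgn k (b.1 * a.1 + b.2 * (a.2 + 1)) :=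
      sgn_congr ⟨-b.2, by simp [dot]; ring⟩
    have h2 : sgn k (dot (-a) (0, 1)) = sgn k a.2 := by rw [dot_neg_left, sgn_neg, sgn_snd]
    rw [h1, lieDer, h2] at h
    exact MixedHP.cls_congr h

end Calculus

/-! ### Induced differential calculi -/

section Induced

variable {k : Type*} [CommRing k] {I : Type*} {deg : I → ℤ × ℤ} [DecidableEq I]
  {π : Polyvector k deg} [Fintype I]

theorem poissonCalculus_isInduced (hπ : π ∈ gr k (polyDeg deg) (0, -2)) :
    (poissonCalculus hπ).IsInduced where
  one := ⟨_, rfl⟩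
  cup _ _ := ⟨_, rfl⟩
  bracket _ _ := ⟨_, rfl⟩
  iota _ _ := ⟨_, rfl⟩
  d _ := ⟨_, rfl⟩

end Induced

/-! ### Signed relabelings of the generators -/

namespace BiSym

variable {k : Type*} [CommRing k] {I J : Type*} {deg : I → ℤ × ℤ} {deg' : J → ℤ × ℤ}

/-- The algebra map `g_i ↦ c_i g_{σ i}`. -/
def relabel (σ : I → J) (c : I → k) (h : ∀ i, deg' (σ i) = deg i) :
    BiSym k deg →ₐ[k] BiSym k deg' :=
  lift (fun i => c i • gen deg' (σ i)) fun i j => by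
    simp only [smul_mul_smul_comm]
    rw [gen_mul_gen, h, h, smul_comm, mul_comm (c i)]

theorem relabel_gen (σ : I → J) (c : I → k) (h : ∀ i, deg' (σ i) = deg i) (i : I) :
    relabel σ c h (gen deg i) = c i • gen deg' (σ i) := lift_gen _ _ _

theorem relabel_mem (σ : I → J) (c : I → k) (h : ∀ i, deg' (σ i) = deg i) {a : ℤ × ℤ}
    {x : BiSym k deg} (hx : x ∈ gr k deg a) : relabel σ c h x ∈ gr k deg' a := by
  refine mem_gr_congr (map_mem_gr (c := 0) (relabel σ c h).toLinearMap ?_ ?_ hx) (add_zero a)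
  · simpa using one_mem_gr
  · intro i a x _ hx
    rw [AlgHom.toLinearMap_apply, map_mul, relabel_gen, add_assoc, ← h]
    exact mul_mem_gr (Submodule.smul_mem _ _ (gen_mem_gr _)) hx

/-- A bijective signed relabeling of the generators is an isomorphism. -/
def relabelEquiv (σ : I ≃ J) (c : I → k) (hc : ∀ i, c i * c i = 1)
    (h : ∀ i, deg' (σ i) = deg i) : BiSym k deg ≃ₐ[k] BiSym k deg' :=
  have h' : ∀ j, deg (σ.symm j) = deg' j := fun j => by rw [← h, σ.apply_symm_apply]
  AlgEquiv.ofAlgHom (relabel σ c h) (relabel σ.symm (fun j => c (σ.symm j)) h')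
    (algHom_ext fun j => by
      rw [AlgHom.comp_apply, relabel_gen, map_smul, relabel_gen, smul_smul, hc, one_smul,
        σ.apply_symm_apply, AlgHom.id_apply])
    (algHom_ext fun i => by
      rw [AlgHom.comp_apply, relabel_gen, map_smul, relabel_gen, smul_smul, σ.symm_apply_apply, hc,
        one_smul, AlgHom.id_apply])

theorem relabelEquiv_mem (σ : I ≃ J) (c : I → k) (hc : ∀ i, c i * c i = 1)
    (h : ∀ i, deg' (σ i) = deg i) {a : ℤ × ℤ} {x : BiSym k deg} (hx : x ∈ gr k deg a) :
    relabelEquiv σ c hc h x ∈ gr k deg' a := relabel_mem _ _ _ hx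

theorem relabelEquiv_symm_mem (σ : I ≃ J) (c : I → k) (hc : ∀ i, c i * c i = 1)
    (h : ∀ i, deg' (σ i) = deg i) {a : ℤ × ℤ} {x : BiSym k deg'} (hx : x ∈ gr k deg' a) :
    (relabelEquiv σ c hc h).symm x ∈ gr k deg a := relabel_mem _ _ _ hx

end BiSym

/-! ### Maps that are compatible with the operations -/

section Functoriality

variable {k : Type*} [CommRing k] {I J : Type*} {deg : I → ℤ × ℤ} {deg' : J → ℤ × ℤ}

theorem map_schouten [DecidableEq I] [Fintype I] [DecidableEq J] [Fintype J]
    (f : Polyvector k deg →ₐ[k] Polyvector k deg')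
    (hf : ∀ a, ∀ P ∈ gr k (polyDeg deg) a, f P ∈ gr k (polyDeg deg') a)
    (hgen : ∀ u v, f (schouten deg (gen (polyDeg deg) u) (gen (polyDeg deg) v)) =
      schouten deg' (f (gen (polyDeg deg) u)) (f (gen (polyDeg deg) v)))
    (P Q : Polyvector k deg) : f (schouten deg P Q) = schouten deg' (f P) (f Q) := by
  have hleft : ∀ u Q, f (schouten deg (gen (polyDeg deg) u) Q) =
      schouten deg' (f (gen (polyDeg deg) u)) (f Q) := by
    intro u Q
    induction Q using homogeneous_induction with
    | add x y hx hy => simp only [map_add, hx, hy]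
    | hom b Q hQ =>
      induction hQ using gr_induction with
      | zero b => simp
      | one => simp [schouten_one_right]
      | gen_mul v b x hx h =>
        rw [schouten_mul_right (gen_mem_gr u) (gen_mem_gr v), map_mul,
          schouten_mul_right (hf _ _ (gen_mem_gr u)) (hf _ _ (gen_mem_gr v)), map_add, map_smul,
          map_mul, map_mul, hgen, h]
      | add b x y _ _ h1 h2 => simp only [map_add, h1, h2]
      | smul b c x _ h => simp only [map_smul, h]
  induction P using homogeneous_induction with
  | add x y hx hy => simp only [map_add, LinearMap.add_apply, hx, hy]
  | hom a P hP =>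
    induction hP using gr_induction with
    | zero a => simp
    | one => simp [schouten_one_left]
    | gen_mul u a x hx h =>
      rw [schouten_mul_left (gen_mem_gr u) hx, map_mul,
        schouten_mul_left (hf _ _ (gen_mem_gr u)) (hf _ _ hx), map_add, map_smul,
        map_mul, map_mul, hleft, h]
    | add a x y _ _ h1 h2 => simp only [map_add, LinearMap.add_apply, h1, h2]
    | smul a c x _ h => simp only [map_smul, LinearMap.smul_apply, h]

theorem map_contract [DecidableEq I] [DecidableEq J] (f : Polyvector k deg →ₐ[k] Polyvector k deg')
    (F : MixedForm k deg →ₐ[k] MixedForm k deg')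
    (hgen : ∀ u ω, F (contract deg (gen (polyDeg deg) u) ω) =
      contract deg' (f (gen (polyDeg deg) u)) (F ω))
    (P : Polyvector k deg) (ω : MixedForm k deg) :
    F (contract deg P ω) = contract deg' (f P) (F ω) := by
  induction P using BiSym.induction generalizing ω with
  | hs r => simp [Module.algebraMap_end_apply]
  | hg u => exact hgen u ω
  | hm x y hx hy => simp [hx, hy]
  | ha x y hx hy => simp [hx, hy]

theorem map_mixedD (F : MixedForm k deg →ₐ[k] MixedForm k deg')
    (hF : ∀ a, ∀ ω ∈ gr k (formDeg deg) a, F ω ∈ gr k (formDeg deg') a)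
    (hgen : ∀ u, F (mixedD deg (gen (formDeg deg) u)) = mixedD deg' (F (gen (formDeg deg) u)))
    (ω : MixedForm k deg) : F (mixedD deg ω) = mixedD deg' (F ω) := by
  induction ω using homogeneous_induction with
  | add x y hx hy => simp only [map_add, hx, hy]
  | hom a ω hω =>
    induction hω using gr_induction with
    | zero a => simp
    | one => simp [mixedD_one]
    | gen_mul u a x hx h =>
      rw [mixedD_mul (gen_mem_gr u), map_mul, mixedD_mul (hF _ _ (gen_mem_gr u)), map_add, map_smul,
        map_mul, map_mul, hgen, h]
    | add a x y _ _ h1 h2 => simp only [map_add, h1, h2]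
    | smul a c x _ h => simp only [map_smul, h]

theorem map_leftPartial [DecidableEq I] [DecidableEq J] (F : BiSym k deg →ₐ[k] BiSym k deg')
    (hF : ∀ a, ∀ x ∈ gr k deg a, F x ∈ gr k deg' a) (i : I) (j : J) (hij : deg i = deg' j)
    (hgen : ∀ u, leftPartial deg' j (F (gen deg u)) = if u = i then 1 else 0)
    (x : BiSym k deg) : F (leftPartial deg i x) = leftPartial deg' j (F x) := by
  induction x using homogeneous_induction with
  | add x y hx hy => simp only [map_add, hx, hy]
  | hom a x hx =>
    induction hx using gr_induction with
    | zero a => simp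
    | one => simp [leftPartial_one]
    | gen_mul u a x hx h =>
      rw [leftPartial_mul_of_mem _ (gen_mem_gr u), map_mul,
        leftPartial_mul_of_mem _ (hF _ _ (gen_mem_gr u)), map_add, map_smul, map_mul, map_mul,
        hgen, h, hij, leftPartial_gen, apply_ite F, map_one, map_zero]
    | add a x y _ _ h1 h2 => simp only [map_add, h1, h2]
    | smul a c x _ h => simp only [map_smul, h]

theorem homologyEquiv_map_grading {V W : Type*} [AddCommGroup V] [Module k V] [AddCommGroup W]
    [Module k W] {D : V →ₗ[k] V} {E : W →ₗ[k] W} (e : V ≃ₗ[k] W)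
    (h : ∀ x, e (D x) = E (e x)) (A : Submodule k V) (B : Submodule k W)
    (hA : ∀ x ∈ A, e x ∈ B) (hB : ∀ y ∈ B, e.symm y ∈ A) :
    ((A.submoduleOf (LinearMap.ker D)).map (Homology.cls D)).map
      (homologyEquiv e h).toLinearMap =
      (B.submoduleOf (LinearMap.ker E)).map (Homology.cls E) := by
  apply le_antisymm
  · rintro _ ⟨_, ⟨x, hx, rfl⟩, rfl⟩
    exact ⟨⟨e x.1, by
      have hx' := x.2
      rw [LinearMap.mem_ker] at hx' ⊢
      rw [← h, hx', map_zero]⟩, hA _ hx, rfl⟩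
  · rintro _ ⟨y, hy, rfl⟩
    refine ⟨_, ⟨⟨e.symm y.1, ?_⟩, hB _ hy, rfl⟩, ?_⟩
    · have hy' := y.2
      rw [LinearMap.mem_ker] at hy' ⊢
      apply e.injective
      rw [h, e.apply_symm_apply, hy', map_zero]
    · exact congrArg (Homology.cls E) (Subtype.ext (e.apply_symm_apply y.1))

end Functoriality

/-! ### Koszul duality -/

section Koszul

variable (k : Type*) [CommRing k] (m n : ℕ)

/-- The sign `-1` of the coordinates `x_i`, and `1` on the other generators. -/
def dualSign : (Fin m ⊕ Fin n) ⊕ (Fin m ⊕ Fin n) → k :=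
  Sum.elim (Sum.elim (fun _ => -1) fun _ => 1) fun _ => 1

theorem dualSign_mul_self (u : (Fin m ⊕ Fin n) ⊕ (Fin m ⊕ Fin n)) :
    dualSign k m n u * dualSign k m n u = 1 := by
  rcases u with (i | i) | i <;> simp [dualSign]

variable {m n} in
theorem degA_inl (i : Fin m) : degA m n (Sum.inl i) = (0, 0) := rfl

variable {m n} in
theorem degA_inr (i : Fin n) : degA m n (Sum.inr i) = (1, 0) := rfl

variable {m n} in
theorem degDual_inl (i : Fin m) : degDual m n (Sum.inl i) = (0, -1) := rfl

variable {m n} in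
theorem degDual_inr (i : Fin n) : degDual m n (Sum.inr i) = (-1, -1) := rfl

variable {m n} in
theorem isEven_degA_inl (i : Fin m) : IsEven (degA m n) (Sum.inl i) := ⟨0, rfl⟩

variable {m n} in
theorem not_isEven_degA_inr (i : Fin n) : ¬IsEven (degA m n) (Sum.inr i) := by simp [degA]

variable {m n} in
theorem not_isEven_degDual_inl (i : Fin m) : ¬IsEven (degDual m n) (Sum.inl i) := by
  simp [degDual]

variable {m n} in
theorem isEven_degDual_inr (i : Fin n) : IsEven (degDual m n) (Sum.inr i) :=
  ⟨-1, rfl⟩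

theorem polyDeg_swap (u : (Fin m ⊕ Fin n) ⊕ (Fin m ⊕ Fin n)) :
    polyDeg (degDual m n) (Equiv.sumComm _ _ u) = polyDeg (degA m n) u := by
  rcases u with (i | i) | (i | i) <;> rfl

theorem formDeg_dual (u : (Fin m ⊕ Fin n) ⊕ (Fin m ⊕ Fin n)) :
    formDeg (degDual m n) (Equiv.refl _ u) = formDeg (degA m n) u := by
  rcases u with (i | i) | (i | i) <;> 
  simp only [Equiv.refl_apply, formDeg, Sum.elim_inl, Sum.elim_inr, isEven_degA_inl, not_isEven_degA_inr,
    not_isEven_degDual_inl, isEven_degDual_inr,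
    if_true, if_false] <;> rfl

/-- `Ψ` as an isomorphism. -/
def dualPolyEquiv : Polyvector k (degA m n) ≃ₐ[k] Polyvector k (degDual m n) :=
  relabelEquiv (Equiv.sumComm _ _) (dualSign k m n) (dualSign_mul_self k m n) (polyDeg_swap m n)

/-- `Φ` as an isomorphism. -/
def dualFormEquiv : MixedForm k (degA m n) ≃ₐ[k] MixedForm k (degDual m n) :=
  relabelEquiv (Equiv.refl _) (dualSign k m n) (dualSign_mul_self k m n) (formDeg_dual m n)

theorem coe_dualPolyEquiv : (dualPolyEquiv k m n : _ →ₐ[k] _) = dualPoly k m n := by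
  refine algHom_ext fun u => (relabel_gen _ _ (polyDeg_swap m n) u).trans ?_
  rw [dualPoly, lift_gen]
  rcases u with (i | i) | (i | i) <;> simp [dualSign, dualPolyGen, coord, vect]

theorem coe_dualFormEquiv : (dualFormEquiv k m n : _ →ₐ[k] _) = dualForm k m n := by
  refine algHom_ext fun u => (relabel_gen _ _ (formDeg_dual m n) u).trans ?_
  rw [dualForm, lift_gen]
  rcases u with (i | i) | (i | i) <;> simp [dualSign, dualFormGen]

variable {k m n}

theorem dualPolyEquiv_apply (P : Polyvector k (degA m n)) :
    dualPolyEquiv k m n P = dualPoly k m n P := DFunLike.congr_fun (coe_dualPolyEquiv k m n) P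

theorem dualFormEquiv_apply (ω : MixedForm k (degA m n)) :
    dualFormEquiv k m n ω = dualForm k m n ω := DFunLike.congr_fun (coe_dualFormEquiv k m n) ω

theorem dualPoly_mem {a : ℤ × ℤ} {P : Polyvector k (degA m n)}
    (hP : P ∈ gr k (polyDeg (degA m n)) a) :
    dualPoly k m n P ∈ gr k (polyDeg (degDual m n)) a := by
  rw [← dualPolyEquiv_apply]
  exact relabelEquiv_mem _ _ _ _ hP

theorem dualForm_mem {a : ℤ × ℤ} {ω : MixedForm k (degA m n)}
    (hω : ω ∈ gr k (formDeg (degA m n)) a) :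
    dualForm k m n ω ∈ gr k (formDeg (degDual m n)) a := by
  rw [← dualFormEquiv_apply]
  exact relabelEquiv_mem _ _ _ _ hω

theorem dualPoly_gen (u : (Fin m ⊕ Fin n) ⊕ (Fin m ⊕ Fin n)) :
    dualPoly k m n (gen _ u) = dualPolyGen k m n u := lift_gen _ _ _

theorem dualForm_gen (u : (Fin m ⊕ Fin n) ⊕ (Fin m ⊕ Fin n)) :
    dualForm k m n (gen _ u) = dualFormGen k m n u := lift_gen _ _ _

/-- `Ψ` preserves the bracket. -/
theorem dualPoly_schouten (P Q : Polyvector k (degA m n)) :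
    dualPoly k m n (schouten (degA m n) P Q) =
      schouten (degDual m n) (dualPoly k m n P) (dualPoly k m n Q) := by
  refine map_schouten _ (fun _ _ hP => dualPoly_mem hP) (fun u v => ?_) P Q
  rw [dualPoly_gen, dualPoly_gen]
  rcases u with (i | i) | (i | i) <;> rcases v with (j | j) | (j | j) <;>
  simp [dualPolyGen, coord, vect, schouten_coord_coord, schouten_vect_vect, schouten_coord_vect,
    schouten_vect_coord, apply_ite (dualPoly k m n), degA_inl, degA_inr, degDual_inl, degDual_inr, sgn] <;>
  split_ifs <;> simp

theorem dualForm_mixedD (ω : MixedForm k (degA m n)) :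
    dualForm k m n (mixedD (degA m n) ω) = mixedD (degDual m n) (dualForm k m n ω) := by
  refine map_mixedD _ (fun _ _ hω => dualForm_mem hω) (fun u => ?_) ω
  rcases u with (i | i) | (i | i) <;>
  simp [mixedD_inl, mixedD_inr, dualForm_gen, dualFormGen, mixedCoeff, isEven_degA_inl, not_isEven_degA_inr,
    not_isEven_degDual_inl, isEven_degDual_inr,
    degA_inr, degDual_inl, sgn]

theorem dualForm_leftPartial (i : Fin m ⊕ Fin n) (ω : MixedForm k (degA m n)) :
    dualForm k m n (leftPartial (formDeg (degA m n)) (Sum.inr i) ω) =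
      leftPartial (formDeg (degDual m n)) (Sum.inr i) (dualForm k m n ω) := by
  refine map_leftPartial _ (fun _ _ hω => dualForm_mem hω) _ _ (formDeg_dual m n _).symm
    (fun u => ?_) ω
  rcases u with (j | j) | (j | j) <;> simp [dualForm_gen, dualFormGen, leftPartial_gen]

/-- `Ψ` and `Φ` preserve the contraction. -/
theorem dualForm_contract (P : Polyvector k (degA m n)) (ω : MixedForm k (degA m n)) :
    dualForm k m n (contract (degA m n) P ω) =
      contract (degDual m n) (dualPoly k m n P) (dualForm k m n ω) := by
  refine map_contract _ _ (fun u ω => ?_) P ω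
  rw [dualPoly_gen]
  rcases u with (i | i) | (i | i) <;>
  simp [contract_gen, contractGen, dualPolyGen, coord, vect, dualForm_gen, dualFormGen,
    isEven_degA_inl, not_isEven_degA_inr,
    not_isEven_degDual_inl, isEven_degDual_inr] <;>
  exact dualForm_leftPartial _ ω

theorem dualPoly_coboundary (π P : Polyvector k (degA m n)) :
    dualPoly k m n (coboundary (degA m n) π P) =
      coboundary (degDual m n) (dualPoly k m n π) (dualPoly k m n P) := dualPoly_schouten P π

theorem dualForm_boundary (π : Polyvector k (degA m n)) (ω : MixedForm k (degA m n)) :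
    dualForm k m n (boundary (degA m n) π ω) =
      boundary (degDual m n) (dualPoly k m n π) (dualForm k m n ω) := by
  simp [boundary, dualForm_contract, dualForm_mixedD]

/-- The isomorphism of the differential calculi of Koszul dual Poisson structures. -/
def koszulIso {π : Polyvector k (degA m n)}
    (hπ : π ∈ gr k (polyDeg (degA m n)) (0, -2))
    (hπ' : dualPoly k m n π ∈ gr k (polyDeg (degDual m n)) (0, -2)) :
    (poissonCalculus hπ).Iso (poissonCalculus hπ') where
  left := homologyEquiv (dualPolyEquiv k m n).toLinearEquiv fun P => by
    simpa only [AlgEquiv.toLinearEquiv_apply, dualPolyEquiv_apply] using dualPoly_coboundary π P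
  right := homologyEquiv (dualFormEquiv k m n).toLinearEquiv fun ω => by
    simpa only [AlgEquiv.toLinearEquiv_apply, dualFormEquiv_apply] using dualForm_boundary π ω
  map_left a := homologyEquiv_map_grading _ _ _ _
    (fun _ hx => relabelEquiv_mem _ _ (dualSign_mul_self k m n) (polyDeg_swap m n) hx)
    (fun _ hx => relabelEquiv_symm_mem _ _ (dualSign_mul_self k m n) (polyDeg_swap m n) hx)
  map_right a := homologyEquiv_map_grading _ _ _ _
    (fun _ hx => relabelEquiv_mem _ _ (dualSign_mul_self k m n) (formDeg_dual m n) hx)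
    (fun _ hx => relabelEquiv_symm_mem _ _ (dualSign_mul_self k m n) (formDeg_dual m n) hx)
  map_one := HP.cls_congr (map_one (dualPolyEquiv k m n))
  map_cup x y := by
    obtain ⟨P, rfl⟩ := HP.cls_surjective x
    obtain ⟨Q, rfl⟩ := HP.cls_surjective y
    exact HP.cls_congr (map_mul (dualPolyEquiv k m n) P.1 Q.1)
  map_bracket x y := by
    obtain ⟨P, rfl⟩ := HP.cls_surjective x
    obtain ⟨Q, rfl⟩ := HP.cls_surjective y
    have h := dualPoly_schouten P.1 Q.1
    simp only [← dualPolyEquiv_apply] at h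
    exact HP.cls_congr h
  map_iota x y := by
    obtain ⟨P, rfl⟩ := HP.cls_surjective x
    obtain ⟨ω, rfl⟩ := MixedHP.cls_surjective y
    have h := dualForm_contract P.1 ω.1
    simp only [← dualPolyEquiv_apply, ← dualFormEquiv_apply] at h
    exact MixedHP.cls_congr h
  map_d y := by
    obtain ⟨ω, rfl⟩ := MixedHP.cls_surjective y
    have h := dualForm_mixedD ω.1
    simp only [← dualFormEquiv_apply] at h
    exact MixedHP.cls_congr h

theorem koszulIso_isInduced {π : Polyvector k (degA m n)}
    (hπ : π ∈ gr k (polyDeg (degA m n)) (0, -2))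
    (hπ' : dualPoly k m n π ∈ gr k (polyDeg (degDual m n)) (0, -2)) :
    (koszulIso hπ hπ').IsInduced where
  left P := by
    have h : dualPoly k m n P.1 ∈ LinearMap.ker (coboundary (degDual m n) (dualPoly k m n π)) := by
      rw [LinearMap.mem_ker, ← dualPoly_coboundary, LinearMap.mem_ker.1 P.2, map_zero]
    have h' := h
    rw [← dualPolyEquiv_apply P.1] at h'
    exact ⟨h, (HP.cls_congr (P := ⟨_, h'⟩) (Q := ⟨_, h⟩) (dualPolyEquiv_apply P.1) :)⟩
  right ω := by
    have h : dualForm k m n ω.1 ∈ LinearMap.ker (boundary (degDual m n) (dualPoly k m n π)) := by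
      rw [LinearMap.mem_ker, ← dualForm_boundary, LinearMap.mem_ker.1 ω.2, map_zero]
    have h' := h
    rw [← dualFormEquiv_apply ω.1] at h'
    exact ⟨h, (MixedHP.cls_congr (P := ⟨_, h'⟩) (Q := ⟨_, h⟩) (dualFormEquiv_apply ω.1) :)⟩

end Koszul

end BiGraded

theorem mainTheorem5 {k : Type*} [Field k] [CharZero k] (m n : ℕ)
    (π : BiGraded.Polyvector k (BiGraded.degA m n))
    (π' : BiGraded.Polyvector k (BiGraded.degDual m n))
    (hπ : BiGraded.IsPoisson (BiGraded.degA m n) π)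
    (hπ' : BiGraded.IsPoisson (BiGraded.degDual m n) π') :
    ∃ (D : BiGraded.DifferentialCalculus k (BiGraded.HP.grading (BiGraded.degA m n) π)
          (BiGraded.MixedHP.grading (BiGraded.degA m n) π))
      (D' : BiGraded.DifferentialCalculus k (BiGraded.HP.grading (BiGraded.degDual m n) π')
          (BiGraded.MixedHP.grading (BiGraded.degDual m n) π')),
      D.IsInduced ∧ D'.IsInduced ∧
        (BiGraded.IsKoszulDual π π' → ∃ e : D.Iso D', e.IsInduced) := by
  refine ⟨BiGraded.poissonCalculus hπ.bidegree, BiGraded.poissonCalculus hπ'.bidegree,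
    BiGraded.poissonCalculus_isInduced _, BiGraded.poissonCalculus_isInduced _, ?_⟩
  rintro ⟨-, rfl⟩
  exact ⟨BiGraded.koszulIso _ _, BiGraded.koszulIso_isInduced _ _⟩
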